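/- **Setting.** Let $W$ be a connected CW complex with exactly one $0$-cell $*$, with $1$-skeleton $W^{(1)}$, and put $\mathcal F=\pi_1(W^{(1)},*)$. Let $(L,\mathcal R)$ be a semi-positive presentation of $\pi_1(W,*)$: $L$ is a system of free generators of $\mathcal F$, and $\mathcal R=\{p_\mu=q_\mu\}_{\mu\in M}$ is a system of defining relations of $\pi_1(W,*)$ in which $p_\mu,q_\mu$ are (possibly empty) words in the free monoid $\mathcal F^+=L^*$. Let $A^+(W)=\langle L\mid p_\mu\sim q_\mu\ (\mu\in M)\rangle^+$ be the monoid with the same generators and relations. For $x,y\in\mathcal F$ let $[x,y]$ be the set of homotopy classes of continuous maps $H:[0,1]^2\to W$ such that $H(\cdot,0)$ and $H(\cdot,1)$ are loops in $W^{(1)}$ representing $x$ and $y$, and $H(0,\cdot)$, $H(1,\cdot)$ are constantly $*$ (homotopies run through maps of this kind). Let $1_x\in[x,x]$ be the class of $(u,v)\mapsto x(u)$. Concatenation in the second variable gives products $\circ:[x,y]\times[y,z]\to[x,z]$ with inverses $[H]^{-1}\in[y,x]$ (reversal of the second variable), and concatenation in the first variable gives products $\cdot:[x,y]\times[z,w]\to[xz,yw]$.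 For $x,y,z,w\in\mathcal F$ and $[T]\in[xzy,xwy]$ put $x\backslash[T]/y:=1_{x^{-1}}\cdot[T]\cdot1_{y^{-1}}\in[z,w]$. Regarding $H$ as a map of triples $([0,1]^2,\partial[0,1]^2,\{0\}\times[0,1])\to(W,W^{(1)},*)$ gives a map $\pi:[x,y]\to\pi_2(W,W^{(1)},*)$; it sends $[x,x]$ into the subgroup $\pi_2(W,*)\subset\pi_2(W,W^{(1)},*)$. Fix a system $\mathcal R_g$ of geometric fundamental relations, i.e. non-empty sets $\mathcal R_g(p_\mu,q_\mu)\subset[p_\mu,q_\mu]$ for $\mu\in M$, and put $\mathcal R_g(q_\mu,p_\mu)=\mathcal R_g(p_\mu,q_\mu)^{-1}$. For words $x,y\in\mathcal F^+$ let $[x,y]_{\mathcal R_g}\subset[x,y]$ be the set of all products $e_1\circ\cdots\circ e_n$ ($n\ge0$, the empty product being $1_x$, for $x=y$) along sequences of words $x=z_0,z_1,\dots,z_n=y$ with $z_{i-1}=a_ib_id_i$, $z_i=a_ic_id_i$, $\{b_i,c_i\}=\{p_\mu,q_\mu\}$ for some $\mu$, and $e_i\in 1_{a_i}\cdot\mathcal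 R_g(b_i,c_i)\cdot1_{d_i}$. A tuple $(a,b,c,d)\in A^+(W)^4$ is *non-cancellative over the kernel $(b,c)$* if $b\ne c$ and $abd=acd$ in $A^+(W)$. A *twin* is a pair $(a,b,c,d)$, $(a',b,c,d')$ of non-cancellative tuples over the same kernel. Given a twin, choose words $\tilde a,\tilde b,\tilde c,\tilde d,\tilde a',\tilde d'\in\mathcal F^+$ representing $a,b,c,d,a',d'$ and put $$\Pi((a,b,c,d),\tilde b,\tilde c)=\tilde a\backslash[\tilde a\tilde b\tilde d,\tilde a\tilde c\tilde d]_{\mathcal R_g}/\tilde d\subset[\tilde b,\tilde c],\qquad G((a,b,d),\tilde b)=\tilde a\backslash[\tilde a\tilde b\tilde d,\tilde a\tilde b\tilde d]_{\mathcal R_g}/\tilde d\subset[\tilde b,\tilde b],$$ and likewise $G((a,c,d),\tilde c)\subset[\tilde c,\tilde c]$, and the same sets for the second tuple of the twin. The $\Pi$-class and the global inertia group of the twin are $$\Pi((a,b,c,d),(a',b,c,d'))=\pi\{[H]\circ[H']^{-1}: [H]\in\Pi((a,b,c,d),\tilde b,\tilde c),\ [H']\in\Pi((a',b,c,d'),\tilde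 b,\tilde c)\}\subset\pi_2(W,*),$$ $$G((a,b,c,d),(a',b,c,d'))=\pi\{[K]\circ[K']^{-1}: [K]\in G((a,b,d),\tilde b),\ [K']\in G((a',b,d'),\tilde b)\}\subset\pi_2(W,*).$$ **Proposition.** 1. The $\Pi$-class and the global inertia group do not depend on the choice of the lifts $\tilde b,\tilde c$, nor on that of $\tilde a,\tilde d,\tilde a',\tilde d'$. Moreover, the global inertia group is also equal to $\pi\{[K]\circ[K']^{-1}: [K]\in G((a,c,d),\tilde c),\ [K']\in G((a',c,d'),\tilde c)\}$. 2. The global inertia group is a subgroup of $\pi_2(W,*)$, and the $\Pi$-class is a single coset of it. -/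

import Mathlib

open Set Topology Topology.Homotopy unitInterval

noncomputable section

namespace PiClasses

/-! ### Fundamental groups, with loops composed from left to right -/

/-- The fundamental group with the product `x * y` represented by the loop that runs first through
`x` and then through `y`. (Mathlib's `FundamentalGroup` uses the opposite order, whence the
opposite group.) -/
abbrev LoopGroup (X : Type*) [TopologicalSpace X] (x : X) : Type _ :=
  (FundamentalGroup X x)ᵐᵒᵖ

/-- The class of a loop. -/
def loopClass {X : Type*} [TopologicalSpace X] {x : X} (γ : Path x x) : LoopGroup X x :=
  MulOpposite.op (FundamentalGroup.fromPath (Path.Homotopic.Quotient.mk γ))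

theorem loopClass_trans {X : Type*} [TopologicalSpace X] {x : X} (γ δ : Path x x) :
    loopClass (γ.trans δ) = loopClass γ * loopClass δ := rfl

/-- The homomorphism of fundamental groups that is induced by the inclusion of a subspace. -/
def inclusionHom {W : Type*} [TopologicalSpace W] (A : Set W) (pt : A) :
    LoopGroup A pt →* LoopGroup W (pt : W) :=
  MonoidHom.op (FundamentalGroup.map (⟨Subtype.val, continuous_subtype_val⟩ : C(A, W)) pt)

/-! ### The system of homotopy equivalences between loops

Throughout this part, `A` is a subspace of `W` and `pt` is a base point in `A`
(in the application `A` is the 1-skeleton of `W`). -/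

section System

variable {W : Type*} [TopologicalSpace W]

/-- Maps `H : [0,1]² → W`, `(u, v) ↦ H (u, v)`, whose bottom edge `v = 0` and top edge `v = 1` are
loops in `A` based at `pt` and which are constantly `pt` on the two edges `u = 0` and `u = 1`.
The space of these maps carries the compact-open topology. -/
abbrev HomotopyMap (A : Set W) (pt : A) : Type _ :=
  {H : C(I × I, W) // (∀ v, H (0, v) = pt) ∧ (∀ v, H (1, v) = pt) ∧
    (∀ u, H (u, 0) ∈ A) ∧ (∀ u, H (u, 1) ∈ A)}

variable {A : Set W} {pt : A}

/-- A path of homotopy maps is obtained from a jointly continuous family of maps. -/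
theorem joined_of_family (F : I → HomotopyMap A pt)
    (hF : Continuous fun p : I × (I × I) => (F p.1).1 p.2) : Joined (F 0) (F 1) :=
  ⟨{ toFun := F
     continuous_toFun := Continuous.subtype_mk
        (ContinuousMap.continuous_of_continuous_uncurry _ hF) _
     source' := rfl
     target' := rfl }⟩

theorem continuous_family {F : I → HomotopyMap A pt} (hF : Continuous F) :
    Continuous fun p : I × (I × I) => (F p.1).1 p.2 :=
  ContinuousMap.continuous_uncurry_of_continuous
    ⟨fun t => (F t).1, continuous_subtype_val.comp hF⟩

namespace HomotopyMap

/-- The loop in `A` on the edge `v = 0`. -/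
def bottom (H : HomotopyMap A pt) : Path pt pt where
  toFun u := ⟨H.1 (u, 0), H.2.2.2.1 u⟩
  continuous_toFun := by fun_prop
  source' := Subtype.ext (H.2.1 0)
  target' := Subtype.ext (H.2.2.1 0)

/-- The loop in `A` on the edge `v = 1`. -/
def top (H : HomotopyMap A pt) : Path pt pt where
  toFun u := ⟨H.1 (u, 1), H.2.2.2.2 u⟩
  continuous_toFun := by fun_prop
  source' := Subtype.ext (H.2.1 1)
  target' := Subtype.ext (H.2.2.1 1)

/-- The constant homotopy `1_γ (u, v) = γ u` of a loop `γ` in `A`. -/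
def const (γ : Path pt pt) : HomotopyMap A pt :=
  ⟨⟨fun p => (γ p.1 : W), by fun_prop⟩, by simp⟩

/-- Reversal of the second variable. -/
def symm (H : HomotopyMap A pt) : HomotopyMap A pt :=
  ⟨⟨fun p => H.1 (p.1, σ p.2), by fun_prop⟩,
    fun v => H.2.1 _, fun v => H.2.2.1 _,
    fun u => by simpa using H.2.2.2.2 u, fun u => by simpa using H.2.2.2.1 u⟩

theorem continuous_glue {Z : Type*} [TopologicalSpace Z] {f g : Z × (I × I) → W}
    (hf : Continuous f) (hg : Continuous g)
    (h : ∀ z v, f (z, 1, v) = g (z, 0, v)) :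
    Continuous fun p : Z × (I × I) =>
      if (p.2.1 : ℝ) ≤ 1 / 2 then f (p.1, projIcc 0 1 zero_le_one (2 * (p.2.1 : ℝ)), p.2.2)
      else g (p.1, projIcc 0 1 zero_le_one (2 * (p.2.1 : ℝ) - 1), p.2.2) := by
  have hp : Continuous (projIcc (0 : ℝ) 1 zero_le_one) := continuous_projIcc
  refine Continuous.if_le ?_ ?_ ?_ ?_ ?_
  · exact hf.comp (by fun_prop)
  · exact hg.comp (by fun_prop)
  · fun_prop
  · fun_prop
  · rintro ⟨z, u, v⟩ hu
    simp only at hu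
    have h1 : projIcc (0 : ℝ) 1 zero_le_one (2 * (u : ℝ)) = 1 := by
      rw [hu]; norm_num
    have h2 : projIcc (0 : ℝ) 1 zero_le_one (2 * (u : ℝ) - 1) = 0 := by
      rw [hu]; norm_num
    simp only [h1, h2]
    exact h z v

/-- The product `H · H'`: concatenation in the first variable. -/
def hcomp (H H' : HomotopyMap A pt) : HomotopyMap A pt :=
  ⟨⟨fun p => if (p.1 : ℝ) ≤ 1 / 2 then H.1 (projIcc 0 1 zero_le_one (2 * (p.1 : ℝ)), p.2)
      else H'.1 (projIcc 0 1 zero_le_one (2 * (p.1 : ℝ) - 1), p.2),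
      (continuous_glue (Z := Unit) (f := fun q => H.1 q.2) (g := fun q => H'.1 q.2)
        (by fun_prop) (by fun_prop) (fun _ v => by rw [H.2.2.1, H'.2.1])).comp
        (Continuous.prodMk continuous_const continuous_id : Continuous fun p : I × I => ((), p))⟩,
    fun v => by simpa using H.2.1 v,
    fun v => by
      have h : ¬ (((1 : I) : ℝ) ≤ 1 / 2) := by norm_num
      have h2 : projIcc (0 : ℝ) 1 zero_le_one (2 * ((1 : I) : ℝ) - 1) = 1 := by norm_num
      simp only [ContinuousMap.coe_mk]
      rw [if_neg h, h2]
      exact H'.2.2.1 v,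
    fun u => by
      simp only [ContinuousMap.coe_mk]
      split_ifs
      · exact H.2.2.2.1 _
      · exact H'.2.2.2.1 _,
    fun u => by
      simp only [ContinuousMap.coe_mk]
      split_ifs
      · exact H.2.2.2.2 _
      · exact H'.2.2.2.2 _⟩

/-- `H₃` is the product `H₁ ∘ H₂`, the concatenation in the second variable. It is formed when the
top edge of `H₁` coincides with the bottom edge of `H₂`. -/
def IsVComp (H₁ H₂ H₃ : HomotopyMap A pt) : Prop :=
  (∀ u, H₁.1 (u, 1) = H₂.1 (u, 0)) ∧
  ∀ u v : I, H₃.1 (u, v) =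
    if (v : ℝ) ≤ 1 / 2 then H₁.1 (u, projIcc 0 1 zero_le_one (2 * (v : ℝ)))
    else H₂.1 (u, projIcc 0 1 zero_le_one (2 * (v : ℝ) - 1))

end HomotopyMap

variable (A pt) in
/-- Homotopy classes of homotopy maps: the arc-connected components of the space of homotopy maps.
The classes in `π₁(A, pt)` of the bottom and top edges do not change along an arc, so an arc that
starts at a map from `x` to `y` runs in the space of maps from `x` to `y`. -/
abbrev HClass : Type _ := ZerothHomotopy (HomotopyMap A pt)

namespace HClass

/-- The set `[x, y]` of classes of homotopy equivalence maps from `x` to `y`, for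
`x, y ∈ π₁(A, pt)`. -/
def between (x y : LoopGroup A pt) : Set (HClass A pt) :=
  {q | ∃ H : HomotopyMap A pt,
    ZerothHomotopy.mk H = q ∧ loopClass H.bottom = x ∧ loopClass H.top = y}

/-- The identity class `1_x ∈ [x, x]`. -/
def one (x : LoopGroup A pt) : HClass A pt :=
  Quotient.lift (s := Path.Homotopic.setoid pt pt)
    (fun γ => ZerothHomotopy.mk (HomotopyMap.const γ))
    (by
      rintro γ δ ⟨F⟩
      refine Quotient.sound ?_
      have h := joined_of_family (A := A) (pt := pt) (fun t => HomotopyMap.const (F.eval t))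
        (by
          change Continuous fun p : I × (I × I) => ((F (p.1, p.2.1) : A) : W)
          fun_prop)
      change Joined _ _
      simpa using h)
    (FundamentalGroup.toPath x.unop)

/-- The inverse `[H]⁻¹ ∈ [y, x]` of `[H] ∈ [x, y]` with respect to `∘`. -/
def symm (q : HClass A pt) : HClass A pt :=
  ZerothHomotopy.lift (fun H => ZerothHomotopy.mk H.symm)
    (fun H H' Γ => Quotient.sound (by
      have hΓ := continuous_family Γ.continuous
      have h := joined_of_family (fun t => (Γ t).symm)
        (by
          change Continuous fun p : I × (I × I) => (Γ p.1).1 (p.2.1, σ p.2.2)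
          exact hΓ.comp (by fun_prop :
            Continuous fun p : I × (I × I) => (p.1, (p.2.1, σ p.2.2))))
      change Joined _ _
      simpa using h)) q

theorem hcomp_joined {H₀ H₁ H₀' H₁' : HomotopyMap A pt} (Γ : Path H₀ H₁) (Γ' : Path H₀' H₁') :
    Joined (H₀.hcomp H₀') (H₁.hcomp H₁') := by
  have h := joined_of_family (fun t => (Γ t).hcomp (Γ' t))
    (HomotopyMap.continuous_glue (continuous_family Γ.continuous)
      (continuous_family Γ'.continuous)
      (fun t v => by rw [(Γ t).2.2.1, (Γ' t).2.1]))
  simpa using h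

/-- The product `[H] · [H'] ∈ [x z, y w]` of `[H] ∈ [x, y]` and `[H'] ∈ [z, w]`. -/
def hcomp (q q' : HClass A pt) : HClass A pt :=
  Quotient.map₂ (sa := pathSetoid _) (sb := pathSetoid _) (sc := pathSetoid _)
    HomotopyMap.hcomp (fun _ _ ⟨Γ⟩ _ _ ⟨Γ'⟩ => hcomp_joined Γ Γ') q q'

/-- `q₃` is the product `q₁ ∘ q₂`: there are representatives of `q₁` and `q₂` that fit together
along their common edge and whose concatenation in the second variable represents `q₃`. -/
def IsVComp (q₁ q₂ q₃ : HClass A pt) : Prop :=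
  ∃ H₁ H₂ H₃ : HomotopyMap A pt, ZerothHomotopy.mk H₁ = q₁ ∧ ZerothHomotopy.mk H₂ = q₂ ∧
    ZerothHomotopy.mk H₃ = q₃ ∧ HomotopyMap.IsVComp H₁ H₂ H₃

/-- The two-sided translate `1_x · q · 1_y`. -/
def translate (x y : LoopGroup A pt) (q : HClass A pt) : HClass A pt :=
  ((one x).hcomp q).hcomp (one y)

/-- The division `x \ [T] / y ∈ [z, w]` of `[T] ∈ [x z y, x w y]`, which is
`1_{x⁻¹} · [T] · 1_{y⁻¹} ∈ [x⁻¹ x z y y⁻¹, x⁻¹ x w y y⁻¹] = [z, w]`. -/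
def division (x y : LoopGroup A pt) (q : HClass A pt) : HClass A pt :=
  translate x⁻¹ y⁻¹ q

/-- The set of all differences `[H] ∘ [H']⁻¹` with `[H] ∈ S` and `[H'] ∈ S'`. -/
def differences (S S' : Set (HClass A pt)) : Set (HClass A pt) :=
  {q | ∃ h ∈ S, ∃ h' ∈ S', IsVComp h h'.symm q}

end HClass

/-! ### The relative homotopy set and the immersion -/

variable (A pt) in
/-- Maps of triples `([0,1]², ∂[0,1]², {0} × [0,1]) → (W, A, pt)`. -/
abbrev RelMap : Type _ :=
  {H : C(I × I, W) // (∀ v, H (0, v) = pt) ∧ (∀ v, H (1, v) ∈ A) ∧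
    (∀ u, H (u, 0) ∈ A) ∧ (∀ u, H (u, 1) ∈ A)}

variable (A pt) in
/-- The second relative homotopy group `π₂(W, A, pt)` (as a set). -/
abbrev RelPi2 : Type _ := ZerothHomotopy (RelMap A pt)

theorem RelMap.joined_of_family (F : I → RelMap A pt)
    (hF : Continuous fun p : I × (I × I) => (F p.1).1 p.2) : Joined (F 0) (F 1) :=
  ⟨{ toFun := F
     continuous_toFun := Continuous.subtype_mk
        (ContinuousMap.continuous_of_continuous_uncurry _ hF) _
     source' := rfl
     target' := rfl }⟩

/-- A homotopy map is in particular a map of triples. -/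
def HomotopyMap.toRel (H : HomotopyMap A pt) : RelMap A pt :=
  ⟨H.1, H.2.1, fun v => by rw [H.2.2.1 v]; exact pt.2, H.2.2.2⟩

/-- The immersion `π` of the system `[x, y]` into `π₂(W, A, pt)`. -/
def immersion (q : HClass A pt) : RelPi2 A pt :=
  ZerothHomotopy.lift (fun H => ZerothHomotopy.mk H.toRel)
    (fun H H' Γ => Quotient.sound (by
      have h := RelMap.joined_of_family (fun t => (Γ t).toRel)
        (continuous_family Γ.continuous)
      change Joined _ _
      simpa using h)) q

theorem pair_mem_boundary {p : I × I} (h : p.1 = 0 ∨ p.1 = 1 ∨ p.2 = 0 ∨ p.2 = 1) :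
    (![p.1, p.2] : Fin 2 → I) ∈ Cube.boundary (Fin 2) := by
  rcases h with h | h | h | h
  · exact ⟨0, Or.inl h⟩
  · exact ⟨0, Or.inr h⟩
  · exact ⟨1, Or.inl h⟩
  · exact ⟨1, Or.inr h⟩

theorem continuous_pair : Continuous fun p : I × I => (![p.1, p.2] : Fin 2 → I) := by
  refine continuous_pi fun i => ?_
  fin_cases i
  · exact continuous_fst
  · exact continuous_snd

/-- A map `([0,1]², ∂[0,1]²) → (W, pt)` as a map of triples. -/
def RelMap.ofGenLoop (g : Ω^ (Fin 2) W (pt : W)) : RelMap A pt :=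
  ⟨⟨fun p => g ![p.1, p.2], g.1.continuous.comp continuous_pair⟩,
    fun v => g.2 _ (pair_mem_boundary (p := (0, v)) (by simp)),
    fun v => by
      have h : g ![1, v] = pt := g.2 _ (pair_mem_boundary (p := (1, v)) (by simp))
      exact (show g ![1, v] ∈ A by rw [h]; exact pt.2),
    fun u => by
      have h : g ![u, 0] = pt := g.2 _ (pair_mem_boundary (p := (u, 0)) (by simp))
      exact (show g ![u, 0] ∈ A by rw [h]; exact pt.2),
    fun u => by
      have h : g ![u, 1] = pt := g.2 _ (pair_mem_boundary (p := (u, 1)) (by simp))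
      exact (show g ![u, 1] ∈ A by rw [h]; exact pt.2)⟩

variable (A pt) in
/-- The map `π₂(W, pt) → π₂(W, A, pt)` of the long exact homotopy sequence. -/
def pi2ToRel (s : π_ 2 W (pt : W)) : RelPi2 A pt :=
  Quotient.lift (s := GenLoop.Homotopic.setoid (Fin 2) (pt : W))
    (fun g => ZerothHomotopy.mk (RelMap.ofGenLoop g))
    (by
      rintro g g' ⟨F⟩
      refine Quotient.sound ?_
      have hF : ∀ t, ∀ y ∈ Cube.boundary (Fin 2), F (t, y) = pt :=
        fun t y hy => (F.eq_fst t hy).trans (g.2 y hy)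
      have h := RelMap.joined_of_family (A := A) (pt := pt)
        (fun t => RelMap.ofGenLoop ⟨⟨fun y => F (t, y), by fun_prop⟩, hF t⟩)
        (F.continuous.comp (continuous_fst.prodMk (continuous_pair.comp continuous_snd)))
      change Joined _ _
      have e₀ : ∀ y, F (0, y) = g y := fun y => F.apply_zero y
      have e₁ : ∀ y, F (1, y) = g' y := fun y => F.apply_one y
      convert h using 1
      · exact congrArg RelMap.ofGenLoop (GenLoop.ext _ _ fun y => (e₀ y).symm)
      · exact congrArg RelMap.ofGenLoop (GenLoop.ext _ _ fun y => (e₁ y).symm)) s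

/-- The part of `π₂(W, pt)` that corresponds to a set of classes `S ⊆ [x, x]` under the immersion,
where `π₂(W, pt)` is regarded as a part of `π₂(W, A, pt)` by means of the long exact sequence.
(If `A` is the 1-skeleton, then `π₂(A, pt)` is trivial, `pi2ToRel` is injective, and the image of
`[x, x]` under the immersion is the image of `pi2ToRel`, the kernel of the boundary map.) -/
def toPi2 (S : Set (HClass A pt)) : Set (π_ 2 W (pt : W)) :=
  {s | ∃ q ∈ S, immersion q = pi2ToRel A pt s}

end System

/-! ### Semi-positively presented spaces -/

section Presentation

/-- A based CW complex with exactly one vertex, the base point. -/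
structure OneVertexComplex (W : Type*) [TopologicalSpace W] [T2Space W]
    [CWComplex (univ : Set W)] where
  base : W
  skeleton_zero : (CWComplex.skeleton (univ : Set W) 0 : Set W) = {base}

variable {W : Type*} [TopologicalSpace W] [T2Space W] [CWComplex (univ : Set W)]

variable (W) in
/-- The 1-skeleton. -/
def graph : Set W := (CWComplex.skeleton (univ : Set W) 1 : Set W)

/-- The base point as a point of the 1-skeleton. -/
def OneVertexComplex.pt (B : OneVertexComplex W) : graph W :=
  ⟨B.base, CWComplex.skeleton_mono (C := (univ : Set W)) zero_le_one
    (by rw [B.skeleton_zero]; rfl)⟩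

/-- A semi-positive presentation of the fundamental group of a one-vertex complex: a system
`gen` of free generators of the fundamental group of the 1-skeleton, and a system of defining
relations `lhs μ = rhs μ` of the fundamental group of `W`, where `lhs μ` and `rhs μ` are (possibly
empty) words in the generators. -/
structure SemiPositivePresentation (B : OneVertexComplex W) (Λ M : Type*) where
  gen : Λ → LoopGroup (graph W) B.pt
  gen_free : Function.Bijective (FreeGroup.lift gen)
  lhs : M → FreeMonoid Λ
  rhs : M → FreeMonoid Λ
  /-- Every loop in `W` comes from the 1-skeleton. -/
  surjective : Function.Surjective (inclusionHom (graph W) B.pt)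
  /-- The relations among the generators that hold in `W` are the consequences of the
  relations `lhs μ = rhs μ`. -/
  ker_eq : ((inclusionHom (graph W) B.pt).comp (FreeGroup.lift gen)).ker =
    Subgroup.normalClosure (range fun μ =>
      FreeMonoid.lift FreeGroup.of (lhs μ) * (FreeMonoid.lift FreeGroup.of (rhs μ))⁻¹)

variable {B : OneVertexComplex W} {Λ M : Type*}

namespace SemiPositivePresentation

variable (P : SemiPositivePresentation B Λ M)

/-- The positive element of the fundamental group of the 1-skeleton that is given by a word. -/
def eval : FreeMonoid Λ →* LoopGroup (graph W) B.pt := FreeMonoid.lift P.gen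

/-- The defining relations of the monoid. -/
def rels (U V : FreeMonoid Λ) : Prop := ∃ μ, U = P.lhs μ ∧ V = P.rhs μ

/-- The monoid `A⁺(W)` with the generators and relations of the presentation. -/
abbrev PosMonoid : Type _ := PresentedMonoid P.rels

/-- The element of `A⁺(W)` represented by a word. -/
abbrev toMonoid : FreeMonoid Λ →* P.PosMonoid := PresentedMonoid.mk P.rels

end SemiPositivePresentation

/-- A system of geometric fundamental relations: for each relation a non-empty set
`R_g(lhs μ, rhs μ) ⊆ [lhs μ, rhs μ]`. The set `R_g(rhs μ, lhs μ)` consists of the inverses. -/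
structure GeometricRelations (P : SemiPositivePresentation B Λ M) where
  rel : M → Set (HClass (graph W) B.pt)
  nonempty : ∀ μ, (rel μ).Nonempty
  subset : ∀ μ, rel μ ⊆ HClass.between (P.eval (P.lhs μ)) (P.eval (P.rhs μ))

variable {P : SemiPositivePresentation B Λ M}

namespace GeometricRelations

variable (Rg : GeometricRelations P)

/-- `Rg.Mem x y q` says that `q` belongs to the `R_g`-set `[x, y]_{R_g}` of the words `x` and `y`:
`q` is a product `e₁ ∘ ⋯ ∘ eₙ` (`n ≥ 0`) along a sequence of elementary transformations that leads
from `x` to `y`, where `eᵢ` has the form `1_a · r · 1_d` with `r` or its inverse in one of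
the given sets. -/
inductive Mem : FreeMonoid Λ → FreeMonoid Λ → HClass (graph W) B.pt → Prop
  | one (x : FreeMonoid Λ) : Mem x x (HClass.one (P.eval x))
  | forward {x a d : FreeMonoid Λ} {μ : M} {q r s : HClass (graph W) B.pt}
      (hq : Mem x (a * P.lhs μ * d) q) (hr : r ∈ Rg.rel μ)
      (hs : HClass.IsVComp q (HClass.translate (P.eval a) (P.eval d) r) s) :
      Mem x (a * P.rhs μ * d) s
  | backward {x a d : FreeMonoid Λ} {μ : M} {q r s : HClass (graph W) B.pt}
      (hq : Mem x (a * P.rhs μ * d) q) (hr : r ∈ Rg.rel μ)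
      (hs : HClass.IsVComp q (HClass.translate (P.eval a) (P.eval d) r.symm) s) :
      Mem x (a * P.lhs μ * d) s

/-- The `R_g`-set `[x, y]_{R_g}`. -/
def rgSet (x y : FreeMonoid Λ) : Set (HClass (graph W) B.pt) := {q | Rg.Mem x y q}

/-- The division set `a \ [a b d, a c d]_{R_g} / d`. This is `Π((a,b,c,d), b, c)`, and it
is the division inertia group `G((a,b,d), b)` for `c = b`. -/
def divisionSet (a b c d : FreeMonoid Λ) : Set (HClass (graph W) B.pt) :=
  HClass.division (P.eval a) (P.eval d) '' Rg.rgSet (a * b * d) (a * c * d)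

/-- The division inertia group `G((a,b,d), b) = a \ [a b d, a b d]_{R_g} / d`. -/
def divisionInertia (a b d : FreeMonoid Λ) : Set (HClass (graph W) B.pt) :=
  Rg.divisionSet a b b d

end GeometricRelations

/-- Non-cancellative tuples `(a, b, c, d)` over the kernel `(b, c)`. -/
def IsNonCancellative {N : Type*} [Monoid N] (a b c d : N) : Prop :=
  b ≠ c ∧ a * b * d = a * c * d

/-- A twin: two non-cancellative tuples `(a, b, c, d)`, `(a', b, c, d')` over the same kernel. -/
def IsTwin {N : Type*} [Monoid N] (a b c d a' d' : N) : Prop :=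
  IsNonCancellative a b c d ∧ IsNonCancellative a' b c d'

/-- A choice of words that lift the entries of a twin from `A⁺(W)`. -/
structure TwinLift (P : SemiPositivePresentation B Λ M) (a b c d a' d' : P.PosMonoid) where
  wa : FreeMonoid Λ
  wb : FreeMonoid Λ
  wc : FreeMonoid Λ
  wd : FreeMonoid Λ
  wa' : FreeMonoid Λ
  wd' : FreeMonoid Λ
  map_a : P.toMonoid wa = a
  map_b : P.toMonoid wb = b
  map_c : P.toMonoid wc = c
  map_d : P.toMonoid wd = d
  map_a' : P.toMonoid wa' = a'
  map_d' : P.toMonoid wd' = d'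

namespace TwinLift

variable {a b c d a' d' : P.PosMonoid} (Rg : GeometricRelations P)
  (l : TwinLift P a b c d a' d')

/-- The `Π`-class of the twin, formed with the lift `l`. -/
def piClass : Set (π_ 2 W (B.pt : W)) :=
  toPi2 (HClass.differences (Rg.divisionSet l.wa l.wb l.wc l.wd)
    (Rg.divisionSet l.wa' l.wb l.wc l.wd'))

/-- The global inertia group of the twin, formed with the lift `l` and the first entry of the
kernel, `π(G((a,b,d),(a',b,d'), b))`. -/
def globalInertia : Set (π_ 2 W (B.pt : W)) :=
  toPi2 (HClass.differences (Rg.divisionInertia l.wa l.wb l.wd)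
    (Rg.divisionInertia l.wa' l.wb l.wd'))

/-- The global inertia group of the twin, formed with the lift `l` and the second entry of the
kernel, `π(G((a,c,d),(a',c,d'), c))`. -/
def globalInertiaSnd : Set (π_ 2 W (B.pt : W)) :=
  toPi2 (HClass.differences (Rg.divisionInertia l.wa l.wc l.wd)
    (Rg.divisionInertia l.wa' l.wc l.wd'))

end TwinLift

end Presentation

end PiClasses

end

noncomputable section

namespace PiClasses

/-! ### Loop classes -/

section System

variable {W : Type*} [TopologicalSpace W] {A : Set W} {pt : A}

/-! All the homotopy theory is moved into one group. A homotopy map is a loop in the space of paths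
in `W` with ends in `A`, so classes form a group under the horizontal product. The identity classes
are the image of a homomorphism `oneHom` into it, and the bottom and top edges give homomorphisms
`src` and `tgt` out of it.

An Eckmann–Hilton argument expresses the vertical product through this group: `q₁ ∘ q₂ = q₁ · 1_y⁻¹
· q₂`, where `y` is the common edge (`HClass.isVComp_iff`). It also shows that a class with trivial
top edge commutes with a class with trivial bottom edge (`HClass.commute`).

Two classes have the same immersion exactly when they differ by a right factor `1_x`
(`immersion_eq_iff`). As `h ∘ h'⁻¹` equals `h · h'⁻¹ · 1_x`, an element of `π₂` lies in the set
given by `S` and `S'` if and only if its image under `pi2Hom` is some `h · h'⁻¹` with `h ∈ S`, `h' ∈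
S'` (`mem_toPi2_differences_iff`). These sets are preimages under `pi2Hom`, so its injectivity plays
no role.

The `R_g`-sets are closed under vertical products, inverses and horizontal products, and are
non-empty between words that are equal in the monoid. Hence division sets can be composed, inverted
and transported to other lifts. Each claim then becomes an identity between elements `h · h'⁻¹`, in
which the unwanted factors cancel or are moved away by `HClass.commute`. -/

theorem loopClass_eq_iff {X : Type*} [TopologicalSpace X] {x : X} {γ δ : Path x x} :
    loopClass γ = loopClass δ ↔ γ.Homotopic δ := by
  unfold loopClass
  rw [MulOpposite.op_inj]
  exact Path.Homotopic.Quotient.eq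

theorem loopClass_surjective {X : Type*} [TopologicalSpace X] {x : X} :
    Function.Surjective (loopClass : Path x x → LoopGroup X x) := by
  intro g
  obtain ⟨γ, h⟩ := Path.Homotopic.Quotient.mk_surjective (FundamentalGroup.toPath g.unop)
  exact ⟨γ, congrArg MulOpposite.op h⟩

theorem loopClass_refl {X : Type*} [TopologicalSpace X] {x : X} :
    loopClass (Path.refl x) = 1 := rfl

/-! ### The group of homotopy classes under horizontal composition -/

/-- The space of paths in `W` with both endpoints in `A`. -/
abbrev EndpointPath (A : Set W) : Type _ := {f : C(I, W) // f 0 ∈ A ∧ f 1 ∈ A}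

/-- The constant path at the base point. -/
def EndpointPath.const (pt : A) : EndpointPath A :=
  ⟨ContinuousMap.const I (pt : W), pt.2, pt.2⟩

namespace HomotopyMap

@[ext]
theorem ext {H H' : HomotopyMap A pt} (h : ∀ u v, H.1 (u, v) = H'.1 (u, v)) : H = H' :=
  Subtype.ext (ContinuousMap.ext fun p => h p.1 p.2)

/-- A homotopy map as a loop in the space of paths with endpoints in `A`. -/
def toLoop (H : HomotopyMap A pt) : Path (EndpointPath.const pt) (EndpointPath.const pt) where
  toFun u := ⟨H.1.curry u, H.2.2.2.1 u, H.2.2.2.2 u⟩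
  continuous_toFun := H.1.curry.continuous.subtype_mk _
  source' := Subtype.ext (ContinuousMap.ext H.2.1)
  target' := Subtype.ext (ContinuousMap.ext H.2.2.1)

/-- A loop in the space of paths with endpoints in `A` as a homotopy map. -/
def ofLoop (γ : Path (EndpointPath.const pt) (EndpointPath.const pt)) : HomotopyMap A pt :=
  ⟨⟨fun p => (γ p.1).1 p.2, ContinuousMap.continuous_uncurry_of_continuous
      ⟨fun u => (γ u).1, continuous_subtype_val.comp γ.continuous⟩⟩,
    fun v => congrArg (fun f : EndpointPath A => f.1 v) γ.source,
    fun v => congrArg (fun f : EndpointPath A => f.1 v) γ.target,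
    fun u => (γ u).2.1, fun u => (γ u).2.2⟩

theorem ofLoop_toLoop (H : HomotopyMap A pt) : ofLoop H.toLoop = H := rfl

theorem toLoop_hcomp (H H' : HomotopyMap A pt) :
    (H.hcomp H').toLoop = H.toLoop.trans H'.toLoop := by
  ext u v
  change (if (u : ℝ) ≤ 1 / 2 then _ else _) =
    ((if (u : ℝ) ≤ 1 / 2 then _ else _ : EndpointPath A)).1 v
  split_ifs <;> rfl

/-- Both sides amount to a continuous function of three variables in `I`; currying turns one into
the other. -/
theorem toLoop_homotopic_iff {H H' : HomotopyMap A pt} :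
    H.toLoop.Homotopic H'.toLoop ↔ Joined H H' := by
  constructor
  · rintro ⟨F⟩
    have h := joined_of_family (A := A) (pt := pt) (fun t => ofLoop (F.eval t)) (by
      refine ContinuousMap.continuous_uncurry_of_continuous
        ⟨fun p : I × I => (F p).1, continuous_subtype_val.comp F.continuous⟩ |>.comp
        (by fun_prop : Continuous fun p : I × (I × I) => ((p.1, p.2.1), p.2.2)))
    simpa [ofLoop_toLoop] using h
  · rintro ⟨Γ⟩
    exact ⟨{
      toFun := fun p => (Γ p.1).toLoop p.2
      continuous_toFun := by
        refine Continuous.subtype_mk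
          (f := fun p : I × I => ((Γ p.1).toLoop p.2).1)
          (ContinuousMap.continuous_of_continuous_uncurry _ ?_) _
        exact (continuous_family Γ.continuous).comp
          (by fun_prop : Continuous fun p : (I × I) × I => (p.1.1, (p.1.2, p.2)))
      map_zero_left := fun u => by simp
      map_one_left := fun u => by simp
      prop' := fun t u hu => by
        rcases hu with rfl | rfl <;> simp }⟩

theorem const_hcomp_const (γ δ : Path pt pt) :
    (const γ).hcomp (const δ) = const (γ.trans δ) := by
  ext u v
  change (if (u : ℝ) ≤ 1 / 2 then _ else _) = ((if (u : ℝ) ≤ 1 / 2 then _ else _ : A) : W)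
  split_ifs <;> rfl

theorem bottom_hcomp (H H' : HomotopyMap A pt) :
    (H.hcomp H').bottom = H.bottom.trans H'.bottom := by
  ext u
  change (if (u : ℝ) ≤ 1 / 2 then _ else _) = ((if (u : ℝ) ≤ 1 / 2 then _ else _ : A) : W)
  split_ifs <;> rfl

theorem top_hcomp (H H' : HomotopyMap A pt) :
    (H.hcomp H').top = H.top.trans H'.top := by
  ext u
  change (if (u : ℝ) ≤ 1 / 2 then _ else _) = ((if (u : ℝ) ≤ 1 / 2 then _ else _ : A) : W)
  split_ifs <;> rfl

end HomotopyMap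

/-! ### The group of classes, identity classes and edge homomorphisms -/

namespace HClass

theorem mk_eq_iff {H H' : HomotopyMap A pt} :
    (ZerothHomotopy.mk H : HClass A pt) = ZerothHomotopy.mk H' ↔ Joined H H' :=
  Quotient.eq (r := pathSetoid _)

/-- The identification of homotopy classes with elements of the fundamental group of the space of
paths with endpoints in `A`. -/
def equivLoopGroup : HClass A pt ≃ LoopGroup (EndpointPath A) (EndpointPath.const pt) :=
  Equiv.ofBijective
    (ZerothHomotopy.lift (fun H => loopClass H.toLoop) fun _ _ Γ =>
      loopClass_eq_iff.2 (HomotopyMap.toLoop_homotopic_iff.2 ⟨Γ⟩))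
    ⟨by
      intro q q' h
      induction q using ZerothHomotopy.rec with | mk H
      induction q' using ZerothHomotopy.rec with | mk H'
      exact mk_eq_iff.2 (HomotopyMap.toLoop_homotopic_iff.1 (loopClass_eq_iff.1 h)),
    fun g => by
      obtain ⟨γ, rfl⟩ := loopClass_surjective g
      exact ⟨ZerothHomotopy.mk (HomotopyMap.ofLoop γ), rfl⟩⟩

/-- Homotopy classes form a group under horizontal composition. -/
instance : Group (HClass A pt) := equivLoopGroup.group

theorem mul_eq_hcomp (q q' : HClass A pt) : q * q' = q.hcomp q' := by
  induction q using ZerothHomotopy.rec with | mk H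
  induction q' using ZerothHomotopy.rec with | mk H'
  refine equivLoopGroup.injective ?_
  change equivLoopGroup (equivLoopGroup.symm _) = loopClass (H.hcomp H').toLoop
  rw [Equiv.apply_symm_apply, HomotopyMap.toLoop_hcomp]
  rfl

theorem mk_hcomp (H H' : HomotopyMap A pt) :
    (ZerothHomotopy.mk (H.hcomp H') : HClass A pt) = ZerothHomotopy.mk H * ZerothHomotopy.mk H' :=
  (mul_eq_hcomp (ZerothHomotopy.mk H) (ZerothHomotopy.mk H')).symm

theorem one_loopClass (γ : Path pt pt) :
    (one (loopClass γ) : HClass A pt) = ZerothHomotopy.mk (HomotopyMap.const γ) := rfl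

/-- The identity classes form a copy of the fundamental group of `A`. -/
def oneHom : LoopGroup A pt →* HClass A pt :=
  MonoidHom.mk' one (by
    intro x y
    obtain ⟨γ, rfl⟩ := loopClass_surjective x
    obtain ⟨δ, rfl⟩ := loopClass_surjective y
    rw [← loopClass_trans, one_loopClass, one_loopClass, one_loopClass,
      ← HomotopyMap.const_hcomp_const, mk_hcomp])

theorem one_eq (x : LoopGroup A pt) : one x = oneHom x := rfl

theorem oneHom_loopClass (γ : Path pt pt) :
    oneHom (loopClass γ) = (ZerothHomotopy.mk (HomotopyMap.const γ) : HClass A pt) := rfl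

theorem translate_eq (x y : LoopGroup A pt) (q : HClass A pt) :
    translate x y q = oneHom x * q * oneHom y := by
  rw [translate, mul_eq_hcomp, mul_eq_hcomp]; rfl

/-- The class of the bottom edge. -/
def src : HClass A pt →* LoopGroup A pt :=
  MonoidHom.mk' (ZerothHomotopy.lift (fun H => loopClass H.bottom) fun H H' Γ =>
      loopClass_eq_iff.2 ⟨{
        toFun := fun p => (Γ p.1).bottom p.2
        continuous_toFun := by
          refine Continuous.subtype_mk (f := fun p : I × I => (Γ p.1).1 (p.2, 0)) ?_ _
          exact (continuous_family Γ.continuous).comp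
            (by fun_prop : Continuous fun p : I × I => (p.1, (p.2, (0 : I))))
        map_zero_left := fun u => by simp
        map_one_left := fun u => by simp
        prop' := fun t u hu => by rcases hu with rfl | rfl <;> simp }⟩)
    (by
      intro q q'
      induction q using ZerothHomotopy.rec with | mk H
      induction q' using ZerothHomotopy.rec with | mk H'
      rw [← mk_hcomp]
      change loopClass _ = loopClass _ * loopClass _
      rw [HomotopyMap.bottom_hcomp, loopClass_trans])

/-- The class of the top edge. -/
def tgt : HClass A pt →* LoopGroup A pt :=
  MonoidHom.mk' (ZerothHomotopy.lift (fun H => loopClass H.top) fun H H' Γ =>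
      loopClass_eq_iff.2 ⟨{
        toFun := fun p => (Γ p.1).top p.2
        continuous_toFun := by
          refine Continuous.subtype_mk (f := fun p : I × I => (Γ p.1).1 (p.2, 1)) ?_ _
          exact (continuous_family Γ.continuous).comp
            (by fun_prop : Continuous fun p : I × I => (p.1, (p.2, (1 : I))))
        map_zero_left := fun u => by simp
        map_one_left := fun u => by simp
        prop' := fun t u hu => by rcases hu with rfl | rfl <;> simp }⟩)
    (by
      intro q q'
      induction q using ZerothHomotopy.rec with | mk H
      induction q' using ZerothHomotopy.rec with | mk H'
      rw [← mk_hcomp]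
      change loopClass _ = loopClass _ * loopClass _
      rw [HomotopyMap.top_hcomp, loopClass_trans])

@[simp]
theorem src_oneHom (x : LoopGroup A pt) : src (oneHom x) = x := by
  obtain ⟨γ, rfl⟩ := loopClass_surjective x
  rfl

@[simp]
theorem tgt_oneHom (x : LoopGroup A pt) : tgt (oneHom x) = x := by
  obtain ⟨γ, rfl⟩ := loopClass_surjective x
  rfl

theorem mem_between_iff {x y : LoopGroup A pt} {q : HClass A pt} :
    q ∈ between x y ↔ src q = x ∧ tgt q = y := by
  induction q using ZerothHomotopy.rec with | mk H
  constructor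
  · rintro ⟨H', h, h0, h1⟩
    rw [← h]
    exact ⟨h0, h1⟩
  · rintro ⟨h0, h1⟩
    exact ⟨H, rfl, h0, h1⟩

end HClass

/-! ### Vertical composition -/

namespace HomotopyMap

/-- Reparametrization of the second variable. -/
def reparam (H : HomotopyMap A pt) (ψ : C(I, I)) (h₀ : ψ 0 = 0 ∨ ψ 0 = 1)
    (h₁ : ψ 1 = 0 ∨ ψ 1 = 1) : HomotopyMap A pt :=
  ⟨⟨fun p => H.1 (p.1, ψ p.2), by fun_prop⟩, fun v => H.2.1 _, fun v => H.2.2.1 _,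
    fun u => by
      rcases h₀ with h | h <;> simp only [ContinuousMap.coe_mk, h]
      exacts [H.2.2.2.1 u, H.2.2.2.2 u],
    fun u => by
      rcases h₁ with h | h <;> simp only [ContinuousMap.coe_mk, h]
      exacts [H.2.2.2.1 u, H.2.2.2.2 u]⟩

/-- The straight-line homotopy from `ψ` to `ψ'` is fixed at both ends of `I`, so the bottom and top
edges stay in `A` throughout. -/
theorem reparam_joined (H : HomotopyMap A pt) {ψ ψ' : C(I, I)} (h₀ : ψ 0 = 0 ∨ ψ 0 = 1)
    (h₁ : ψ 1 = 0 ∨ ψ 1 = 1) (h₀' : ψ' 0 = 0 ∨ ψ' 0 = 1) (h₁' : ψ' 1 = 0 ∨ ψ' 1 = 1)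
    (e₀ : ψ 0 = ψ' 0) (e₁ : ψ 1 = ψ' 1) :
    Joined (H.reparam ψ h₀ h₁) (H.reparam ψ' h₀' h₁') := by
  let φ (t v : I) : I := projIcc 0 1 zero_le_one ((1 - (t : ℝ)) * ψ v + t * ψ' v)
  have hφ {t v : I} (h : ψ v = ψ' v) : φ t v = ψ v := by
    have : (1 - (t : ℝ)) * ψ v + t * ψ' v = ψ v := by rw [← h]; ring
    simp only [φ, this, projIcc_val]
  have hc : Continuous fun p : I × I => φ p.1 p.2 := by fun_prop
  have h := joined_of_family (A := A) (pt := pt)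
    (fun t => H.reparam ⟨φ t, hc.comp (by fun_prop : Continuous fun v : I => (t, v))⟩
      (by simpa only [ContinuousMap.coe_mk, hφ e₀] using h₀)
      (by simpa only [ContinuousMap.coe_mk, hφ e₁] using h₁))
    (by
      change Continuous fun p : I × (I × I) => H.1 (p.2.1, φ p.1 p.2.2)
      exact H.1.continuous.comp ((by fun_prop : Continuous fun p : I × (I × I) => p.2.1).prodMk
        (hc.comp (by fun_prop : Continuous fun p : I × (I × I) => (p.1, p.2.2)))))
  convert h using 1
  · ext u v
    simp [reparam, φ]
  · ext u v
    simp [reparam, φ]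

theorem IsVComp.unique {H₁ H₂ H₃ H₃' : HomotopyMap A pt} (h : IsVComp H₁ H₂ H₃)
    (h' : IsVComp H₁ H₂ H₃') : H₃ = H₃' := by
  ext u v
  rw [h.2, h'.2]

/-- The interchange law. It holds strictly, because the two concatenations subdivide independent
variables. -/
theorem IsVComp.hcomp {H₁ H₂ H₃ H₁' H₂' H₃' : HomotopyMap A pt} (h : IsVComp H₁ H₂ H₃)
    (h' : IsVComp H₁' H₂' H₃') :
    IsVComp (H₁.hcomp H₁') (H₂.hcomp H₂') (H₃.hcomp H₃') := by
  refine ⟨fun u => ?_, fun u v => ?_⟩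
  · simp only [HomotopyMap.hcomp, ContinuousMap.coe_mk, h.1, h'.1]
  · simp only [HomotopyMap.hcomp, ContinuousMap.coe_mk, h.2, h'.2]
    split_ifs <;> rfl

theorem projIcc_two_mul_sub_one_of_le {v : I} (h : (v : ℝ) ≤ 1 / 2) :
    projIcc (0 : ℝ) 1 zero_le_one (2 * (v : ℝ) - 1) = 0 :=
  projIcc_of_le_left _ (by linarith)

theorem projIcc_two_mul_of_not_le {v : I} (h : ¬ (v : ℝ) ≤ 1 / 2) :
    projIcc (0 : ℝ) 1 zero_le_one (2 * (v : ℝ)) = 1 :=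
  projIcc_of_right_le _ (by linarith)

theorem exists_isVComp_const (H : HomotopyMap A pt) :
    ∃ H', IsVComp H (const H.top) H' ∧ Joined H' H := by
  let ψ : C(I, I) := ⟨fun v => projIcc 0 1 zero_le_one (2 * (v : ℝ)), by fun_prop⟩
  have h₀ : ψ 0 = 0 := by simp [ψ]
  have h₁ : ψ 1 = 1 := by simp only [ψ, ContinuousMap.coe_mk]; norm_num
  refine ⟨H.reparam ψ (Or.inl h₀) (Or.inr h₁), ⟨fun u => rfl, fun u v => ?_⟩, ?_⟩
  · split_ifs with hv
    · rfl
    · change H.1 (u, projIcc 0 1 zero_le_one (2 * (v : ℝ))) = H.1 (u, 1)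
      rw [projIcc_two_mul_of_not_le hv]
  · exact H.reparam_joined (ψ' := ContinuousMap.id I) _ _ (Or.inl rfl) (Or.inr rfl) h₀ h₁

theorem exists_const_isVComp (H : HomotopyMap A pt) :
    ∃ H', IsVComp (const H.bottom) H H' ∧ Joined H' H := by
  let ψ : C(I, I) := ⟨fun v => projIcc 0 1 zero_le_one (2 * (v : ℝ) - 1), by fun_prop⟩
  have h₀ : ψ 0 = 0 := by simp [ψ]
  have h₁ : ψ 1 = 1 := by simp only [ψ, ContinuousMap.coe_mk]; norm_num
  refine ⟨H.reparam ψ (Or.inl h₀) (Or.inr h₁), ⟨fun u => rfl, fun u v => ?_⟩, ?_⟩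
  · split_ifs with hv
    · change H.1 (u, projIcc 0 1 zero_le_one (2 * (v : ℝ) - 1)) = H.1 (u, 0)
      rw [projIcc_two_mul_sub_one_of_le hv]
    · rfl
  · exact H.reparam_joined (ψ' := ContinuousMap.id I) _ _ (Or.inl rfl) (Or.inr rfl) h₀ h₁

theorem exists_isVComp_symm (H : HomotopyMap A pt) :
    ∃ H', IsVComp H H.symm H' ∧ Joined H' (const H.bottom) := by
  -- The tent function runs through `H` and back again; it is contracted to the constant `0`, with
  -- which it agrees at both ends.
  let ψ : C(I, I) := ⟨fun v => projIcc 0 1 zero_le_one (1 - |2 * (v : ℝ) - 1|), by fun_prop⟩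
  have h₀ : ψ 0 = 0 := by simp [ψ]
  have h₁ : ψ 1 = 0 := by simp only [ψ, ContinuousMap.coe_mk]; norm_num
  refine ⟨H.reparam ψ (Or.inl h₀) (Or.inl h₁), ⟨fun u => ?_, fun u v => ?_⟩, ?_⟩
  · simp [symm]
  · have hv0 := v.2.1
    have hv1 := v.2.2
    split_ifs with hv
    · change H.1 (u, projIcc 0 1 zero_le_one (1 - |2 * (v : ℝ) - 1|)) = _
      rw [abs_of_nonpos (by linarith)]
      congr 3
      ring
    · change H.1 (u, projIcc 0 1 zero_le_one (1 - |2 * (v : ℝ) - 1|)) =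
        H.1 (u, σ (projIcc 0 1 zero_le_one (2 * (v : ℝ) - 1)))
      rw [abs_of_nonneg (by linarith)]
      congr 2
      rw [projIcc_of_mem zero_le_one (⟨by linarith, by linarith⟩ : 2 * (v : ℝ) - 1 ∈ Icc (0 : ℝ) 1),
        projIcc_of_mem zero_le_one
          (⟨by linarith, by linarith⟩ : 1 - (2 * (v : ℝ) - 1) ∈ Icc (0 : ℝ) 1)]
      rfl
  · exact H.reparam_joined (ψ' := ContinuousMap.const I 0) _ _ (Or.inl rfl) (Or.inl rfl) h₀ h₁

/-- The concatenation in the second variable of continuous families of maps is continuous. -/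
theorem continuous_vglue {Z : Type*} [TopologicalSpace Z] {f g : Z × (I × I) → W}
    (hf : Continuous f) (hg : Continuous g) (h : ∀ z u, f (z, u, 1) = g (z, u, 0)) :
    Continuous fun p : Z × (I × I) =>
      if (p.2.2 : ℝ) ≤ 1 / 2 then f (p.1, p.2.1, projIcc 0 1 zero_le_one (2 * (p.2.2 : ℝ)))
      else g (p.1, p.2.1, projIcc 0 1 zero_le_one (2 * (p.2.2 : ℝ) - 1)) :=
  (continuous_glue (f := fun p => f (p.1, p.2.2, p.2.1)) (g := fun p => g (p.1, p.2.2, p.2.1))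
    (hf.comp (by fun_prop)) (hg.comp (by fun_prop)) (fun z v => h z v)).comp
    (by fun_prop : Continuous fun p : Z × (I × I) => (p.1, p.2.2, p.2.1))

/-- The concatenation of two maps in the second variable. -/
def vcomp (H₁ H₂ : HomotopyMap A pt) (h : ∀ u, H₁.1 (u, 1) = H₂.1 (u, 0)) : HomotopyMap A pt :=
  ⟨⟨fun p => if (p.2 : ℝ) ≤ 1 / 2 then H₁.1 (p.1, projIcc 0 1 zero_le_one (2 * (p.2 : ℝ)))
      else H₂.1 (p.1, projIcc 0 1 zero_le_one (2 * (p.2 : ℝ) - 1)),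
      (continuous_vglue (Z := Unit) (f := fun q => H₁.1 q.2) (g := fun q => H₂.1 q.2)
        (by fun_prop) (by fun_prop) (fun _ u => h u)).comp
        (Continuous.prodMk continuous_const continuous_id : Continuous fun p : I × I => ((), p))⟩,
    fun v => by
      simp only [ContinuousMap.coe_mk, H₁.2.1, H₂.2.1, ite_self],
    fun v => by
      simp only [ContinuousMap.coe_mk, H₁.2.2.1, H₂.2.2.1, ite_self],
    fun u => by simpa using H₁.2.2.2.1 u,
    fun u => by
      have h : ¬ (((1 : I) : ℝ) ≤ 1 / 2) := by norm_num
      have h2 : projIcc (0 : ℝ) 1 zero_le_one (2 * ((1 : I) : ℝ) - 1) = 1 := by norm_num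
      simp only [ContinuousMap.coe_mk]
      rw [if_neg h, h2]
      exact H₂.2.2.2.2 u⟩

theorem isVComp_vcomp (H₁ H₂ : HomotopyMap A pt) (h : ∀ u, H₁.1 (u, 1) = H₂.1 (u, 0)) :
    IsVComp H₁ H₂ (vcomp H₁ H₂ h) :=
  ⟨h, fun _ _ => rfl⟩

theorem vcomp_joined {F F' : I → HomotopyMap A pt}
    (hF : Continuous fun p : I × (I × I) => (F p.1).1 p.2)
    (hF' : Continuous fun p : I × (I × I) => (F' p.1).1 p.2)
    (h : ∀ t u, (F t).1 (u, 1) = (F' t).1 (u, 0)) :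
    Joined (vcomp (F 0) (F' 0) (h 0)) (vcomp (F 1) (F' 1) (h 1)) :=
  joined_of_family (fun t => vcomp (F t) (F' t) (h t)) (continuous_vglue hF hF' h)

/-- The map `H` followed by the part up to time `t` of a homotopy in `A` that starts at the top
edge of `H`. -/
def collar (H : HomotopyMap A pt) {γ δ : Path pt pt} (h : H.top = γ) (F : γ.Homotopy δ) (t : I) :
    HomotopyMap A pt :=
  ⟨⟨fun p => if (p.2 : ℝ) * (1 + t) ≤ 1 then
        H.1 (p.1, projIcc 0 1 zero_le_one ((p.2 : ℝ) * (1 + t)))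
      else (F (projIcc 0 1 zero_le_one ((p.2 : ℝ) * (1 + t) - 1), p.1) : W), by
      refine Continuous.if_le (by fun_prop) (by fun_prop) (by fun_prop) (by fun_prop) ?_
      rintro ⟨u, v⟩ e
      simp only at e
      rw [e, sub_self, projIcc_left, projIcc_right]
      change H.1 (u, 1) = ((F (0, u) : A) : W)
      rw [F.apply_zero, ← h]
      rfl⟩,
    fun v => by simp [H.2.1],
    fun v => by simp [H.2.2.1],
    fun u => by simpa using H.2.2.2.1 u,
    fun u => by
      simp only [ContinuousMap.coe_mk]
      split_ifs with ht
      · rw [projIcc_of_right_le _ (by simpa using t.2.1)]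
        exact H.2.2.2.2 u
      · exact (F _).2⟩

section collar

variable (H : HomotopyMap A pt) {γ δ : Path pt pt} (h : H.top = γ) (F : γ.Homotopy δ)

theorem collar_zero : H.collar h F 0 = H := by
  ext u v
  have : (v : ℝ) ≤ 1 := v.2.2
  simp [collar, this]

theorem collar_top (t u : I) : (H.collar h F t).1 (u, 1) = F (t, u) := by
  simp only [collar, ContinuousMap.coe_mk]
  split_ifs with ht
  -- At `v = 1` the first branch requires `1 + t ≤ 1`, so it occurs only for `t = 0`.
  · obtain rfl : t = 0 := Subtype.ext (le_antisymm (by simpa using ht) t.2.1)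
    rw [F.apply_zero, ← h]
    simp
    rfl
  · simp

theorem collar_bottom (t u : I) : (H.collar h F t).1 (u, 0) = H.1 (u, 0) := by
  simp [collar]

theorem continuous_collar :
    Continuous fun p : I × (I × I) => (H.collar h F p.1).1 p.2 := by
  refine Continuous.if_le (by fun_prop) (by fun_prop) (by fun_prop) (by fun_prop) ?_
  rintro ⟨t, u, v⟩ e
  simp only at e
  rw [e, sub_self, projIcc_left, projIcc_right]
  change H.1 (u, 1) = ((F (0, u) : A) : W)
  rw [F.apply_zero, ← h]
  rfl

theorem collar_joined : Joined H (H.collar h F 1) := by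
  have := joined_of_family _ (H.continuous_collar h F)
  rwa [collar_zero] at this

end collar

theorem symm_joined {H H' : HomotopyMap A pt} : Joined H H' → Joined H.symm H'.symm := by
  rintro ⟨Γ⟩
  have h := joined_of_family (fun t => (Γ t).symm) ((continuous_family Γ.continuous).comp
    (by fun_prop : Continuous fun p : I × (I × I) => (p.1, (p.2.1, σ p.2.2))))
  simpa using h

theorem symm_symm (H : HomotopyMap A pt) : H.symm.symm = H := by
  ext u v
  simp [symm]

/-- Reparametrization of the first variable by `u ↦ min 1 (u (1 + s))`. -/
def squeezeLeft (H : HomotopyMap A pt) (s : I) : HomotopyMap A pt :=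
  ⟨⟨fun p => H.1 (projIcc 0 1 zero_le_one ((p.1 : ℝ) * (1 + s)), p.2), by fun_prop⟩,
    fun v => by simpa using H.2.1 v,
    fun v => by
      simp only [ContinuousMap.coe_mk]
      rw [projIcc_of_right_le _ (by simpa using s.2.1)]
      exact H.2.2.1 v,
    fun u => H.2.2.2.1 _, fun u => H.2.2.2.2 _⟩

/-- Reparametrization of the first variable by `u ↦ max 0 (u (1 + s) - s)`. -/
def squeezeRight (H : HomotopyMap A pt) (s : I) : HomotopyMap A pt :=
  ⟨⟨fun p => H.1 (projIcc 0 1 zero_le_one ((p.1 : ℝ) * (1 + s) - s), p.2), by fun_prop⟩,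
    fun v => by
      simp only [ContinuousMap.coe_mk]
      rw [projIcc_of_le_left _ (by simpa using s.2.1)]
      exact H.2.1 v,
    fun v => by simpa using H.2.2.1 v,
    fun u => H.2.2.2.1 _, fun u => H.2.2.2.2 _⟩

theorem squeezeLeft_zero (H : HomotopyMap A pt) : H.squeezeLeft 0 = H := by
  ext u v; simp [squeezeLeft]

theorem squeezeRight_zero (H : HomotopyMap A pt) : H.squeezeRight 0 = H := by
  ext u v; simp [squeezeRight]

theorem squeezeLeft_one (H : HomotopyMap A pt) :
    H.squeezeLeft 1 = H.hcomp (const (Path.refl pt)) := by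
  ext u v
  change H.1 (projIcc 0 1 zero_le_one ((u : ℝ) * (1 + 1)), v) =
    if (u : ℝ) ≤ 1 / 2 then H.1 (projIcc 0 1 zero_le_one (2 * (u : ℝ)), v) else (pt : W)
  rw [show (u : ℝ) * (1 + 1) = 2 * u by ring]
  split_ifs with hu
  · rfl
  · rw [projIcc_two_mul_of_not_le hu, H.2.2.1]

theorem squeezeRight_one (H : HomotopyMap A pt) :
    H.squeezeRight 1 = (const (Path.refl pt)).hcomp H := by
  ext u v
  change H.1 (projIcc 0 1 zero_le_one ((u : ℝ) * (1 + 1) - 1), v) =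
    if (u : ℝ) ≤ 1 / 2 then (pt : W) else H.1 (projIcc 0 1 zero_le_one (2 * (u : ℝ) - 1), v)
  rw [show (u : ℝ) * (1 + 1) - 1 = 2 * u - 1 by ring]
  split_ifs with hu
  · rw [projIcc_two_mul_sub_one_of_le hu, H.2.1]
  · rfl

/-- If the common edge is stationary, the vertical product is also the horizontal one. -/
theorem vcomp_joined_hcomp (H₁ H₂ : HomotopyMap A pt) (h₁ : ∀ u, H₁.1 (u, 1) = pt)
    (h₂ : ∀ u, H₂.1 (u, 0) = pt) :
    Joined (vcomp H₁ H₂ fun u => (h₁ u).trans (h₂ u).symm) (H₁.hcomp H₂) := by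
  -- `H₁` is squeezed into the left half and `H₂` into the right half. The common edge remains
  -- constant, so the vertical product exists at every time of the deformation.
  have h := vcomp_joined (F := H₁.squeezeLeft) (F' := H₂.squeezeRight)
    (by
      change Continuous fun p : I × (I × I) =>
        H₁.1 (projIcc 0 1 zero_le_one ((p.2.1 : ℝ) * (1 + p.1)), p.2.2)
      fun_prop)
    (by
      change Continuous fun p : I × (I × I) =>
        H₂.1 (projIcc 0 1 zero_le_one ((p.2.1 : ℝ) * (1 + p.1) - p.1), p.2.2)
      fun_prop)
    (fun t u => (h₁ _).trans (h₂ _).symm)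
  simp only [squeezeLeft_zero, squeezeRight_zero, squeezeLeft_one, squeezeRight_one] at h
  -- The deformation ends at `(H₁ · 1) ∘ (1 · H₂)`, which by interchange is `(H₁ ∘ 1) · (1 ∘ H₂)`.
  obtain ⟨K₁, hK₁, j₁⟩ := H₁.exists_isVComp_const
  obtain ⟨K₂, hK₂, j₂⟩ := H₂.exists_const_isVComp
  have e₁ : H₁.top = Path.refl pt := Path.ext (funext fun u => Subtype.ext (h₁ u))
  have e₂ : H₂.bottom = Path.refl pt := Path.ext (funext fun u => Subtype.ext (h₂ u))
  rw [e₁] at hK₁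
  rw [e₂] at hK₂
  rw [(isVComp_vcomp _ _ _).unique (hK₁.hcomp hK₂)] at h
  obtain ⟨Γ₁⟩ := j₁
  obtain ⟨Γ₂⟩ := j₂
  exact h.trans (HClass.hcomp_joined Γ₁ Γ₂)

/-- A null-homotopy of the common edge is inserted as a collar on both sides of the cut, which
reduces to the case of a stationary edge. -/
theorem IsVComp.joined_hcomp {H₁ H₂ H₃ : HomotopyMap A pt} (h : IsVComp H₁ H₂ H₃)
    (h₁ : H₁.top.Homotopic (Path.refl pt)) : Joined H₃ (H₁.hcomp H₂) := by
  obtain ⟨F⟩ := h₁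
  have e : H₂.symm.top = H₁.top := by
    ext u
    change H₂.1 (u, σ 1) = H₁.1 (u, 1)
    rw [h.1, symm_one]
  -- The reversed collar grows below `H₂` and is driven by the same `F`, so the two edges agree at
  -- every time `t`.
  let K (t : I) : HomotopyMap A pt := (H₂.symm.collar e F t).symm
  have hK (t u : I) : (K t).1 (u, 0) = F (t, u) := by
    change (H₂.symm.collar e F t).1 (u, σ 0) = _
    rw [symm_zero, collar_top]
  have hj := vcomp_joined (F := H₁.collar rfl F) (F' := K) (H₁.continuous_collar rfl F)
    ((H₂.symm.continuous_collar e F).comp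
      (by fun_prop : Continuous fun p : I × (I × I) => (p.1, (p.2.1, σ p.2.2))))
    (fun t u => (H₁.collar_top rfl F t u).trans (hK t u).symm)
  simp only [K, collar_zero, symm_symm] at hj
  rw [(isVComp_vcomp H₁ H₂ h.1).unique h] at hj
  refine (hj.trans (vcomp_joined_hcomp _ _ (fun u => ?_) (fun u => ?_))).trans ?_
  · rw [collar_top, F.apply_one]; rfl
  · rw [hK, F.apply_one]; rfl
  · obtain ⟨Γ₁⟩ := (H₁.collar_joined rfl F).symm
    obtain ⟨Γ₂⟩ := symm_joined (H₂.symm.collar_joined e F).symm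
    rw [symm_symm] at Γ₂
    exact HClass.hcomp_joined Γ₁ Γ₂

end HomotopyMap

/-! ### The vertical product in terms of the group -/

namespace HClass

theorem IsVComp.mul {q₁ q₂ q₃ q₁' q₂' q₃' : HClass A pt} (h : IsVComp q₁ q₂ q₃)
    (h' : IsVComp q₁' q₂' q₃') : IsVComp (q₁ * q₁') (q₂ * q₂') (q₃ * q₃') := by
  obtain ⟨H₁, H₂, H₃, rfl, rfl, rfl, h⟩ := h
  obtain ⟨H₁', H₂', H₃', rfl, rfl, rfl, h'⟩ := h'
  exact ⟨_, _, _, mk_hcomp _ _, mk_hcomp _ _, mk_hcomp _ _, h.hcomp h'⟩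

theorem isVComp_one (q : HClass A pt) : IsVComp q (oneHom (tgt q)) q := by
  induction q using ZerothHomotopy.rec with | mk H
  obtain ⟨H', h, j⟩ := H.exists_isVComp_const
  exact ⟨H, _, H', rfl, (oneHom_loopClass _).symm, mk_eq_iff.2 j, h⟩

theorem one_isVComp (q : HClass A pt) : IsVComp (oneHom (src q)) q q := by
  induction q using ZerothHomotopy.rec with | mk H
  obtain ⟨H', h, j⟩ := H.exists_const_isVComp
  exact ⟨_, H, H', (oneHom_loopClass _).symm, rfl, mk_eq_iff.2 j, h⟩

theorem isVComp_symm (q : HClass A pt) : IsVComp q q.symm (oneHom (src q)) := by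
  induction q using ZerothHomotopy.rec with | mk H
  obtain ⟨H', h, j⟩ := H.exists_isVComp_symm
  exact ⟨H, _, H', rfl, rfl, (mk_eq_iff.2 j).trans (oneHom_loopClass _).symm, h⟩

theorem IsVComp.tgt_eq_src {q₁ q₂ q₃ : HClass A pt} (h : IsVComp q₁ q₂ q₃) :
    tgt q₁ = src q₂ := by
  obtain ⟨H₁, H₂, H₃, rfl, rfl, rfl, h⟩ := h
  exact congrArg loopClass (Path.ext (funext fun u => Subtype.ext (h.1 u)))

theorem IsVComp.eq_mul {q₁ q₂ q₃ : HClass A pt} (h : IsVComp q₁ q₂ q₃) (h₁ : tgt q₁ = 1) :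
    q₃ = q₁ * q₂ := by
  obtain ⟨H₁, H₂, H₃, rfl, rfl, rfl, h⟩ := h
  rw [← mk_hcomp]
  exact mk_eq_iff.2 (h.joined_hcomp (loopClass_eq_iff.1 h₁))

/-- The vertical product is determined by the horizontal one. -/
theorem isVComp_iff {q₁ q₂ q₃ : HClass A pt} :
    IsVComp q₁ q₂ q₃ ↔ tgt q₁ = src q₂ ∧ q₃ = q₁ * (oneHom (tgt q₁))⁻¹ * q₂ := by
  constructor
  · intro h
    refine ⟨h.tgt_eq_src, ?_⟩
    -- Multiplying all three classes on the right by `1_{y⁻¹}`, with `y = tgt q₁`, makes the common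
    -- edge trivial; the factor is cancelled afterwards.
    have h1 := isVComp_one (oneHom (tgt q₁)⁻¹ : HClass A pt)
    rw [tgt_oneHom] at h1
    have h2 := (h.mul h1).eq_mul (by simp)
    rw [map_inv, ← mul_assoc] at h2
    exact mul_right_cancel h2
  · rintro ⟨h, rfl⟩
    -- Interchange for `q₁ ∘ 1` and `1 ∘ (1_y⁻¹ · q₂)`; the second factor has trivial bottom edge.
    have h1 := (isVComp_one q₁).mul (one_isVComp ((oneHom (tgt q₁))⁻¹ * q₂))
    simpa [h, mul_assoc] using h1

theorem symm_eq (q : HClass A pt) : q.symm = oneHom (tgt q) * q⁻¹ * oneHom (src q) := by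
  have h := (isVComp_iff.1 (isVComp_symm q)).2
  rw [h]
  group

/-- Classes that end at the trivial loop commute with classes that start at it. -/
theorem commute {p q : HClass A pt} (hp : tgt p = 1) (hq : src q = 1) : p * q = q * p := by
  have h1 := one_isVComp q
  have h2 := isVComp_one p
  rw [hq] at h1
  rw [hp] at h2
  -- `(1 ∘ q) · (p ∘ 1) = (1 · p) ∘ (q · 1)`, and the vertical product on the right is along a
  -- trivial edge.
  have h := (h1.mul h2).eq_mul (by simp [hp])
  simpa using h.symm

end HClass

/-! ### The immersion and the second homotopy group -/

theorem RelMap.ext {H H' : RelMap A pt} (h : ∀ u v, H.1 (u, v) = H'.1 (u, v)) : H = H' :=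
  Subtype.ext (ContinuousMap.ext fun p => h p.1 p.2)

theorem RelMap.continuous_family {F : I → RelMap A pt} (hF : Continuous F) :
    Continuous fun p : I × (I × I) => (F p.1).1 p.2 :=
  ContinuousMap.continuous_uncurry_of_continuous
    ⟨fun t => (F t).1, continuous_subtype_val.comp hF⟩

theorem RelMap.mk_eq_iff {H H' : RelMap A pt} :
    (ZerothHomotopy.mk H : RelPi2 A pt) = ZerothHomotopy.mk H' ↔ Joined H H' :=
  Quotient.eq (r := pathSetoid _)

theorem immersion_mk (H : HomotopyMap A pt) :
    immersion (ZerothHomotopy.mk H) = ZerothHomotopy.mk H.toRel := rfl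

/-- In the relative set the right edge may move in `A`, so the block of the constant homotopy can be
cut off from the right. -/
theorem immersion_mul_oneHom (q : HClass A pt) (x : LoopGroup A pt) :
    immersion (q * HClass.oneHom x) = immersion q := by
  induction q using ZerothHomotopy.rec with | mk H
  obtain ⟨γ, rfl⟩ := loopClass_surjective x
  rw [HClass.oneHom_loopClass, ← HClass.mk_hcomp, immersion_mk, immersion_mk, RelMap.mk_eq_iff]
  let K := H.hcomp (HomotopyMap.const γ)
  let φ (t u : I) : I := projIcc 0 1 zero_le_one ((u : ℝ) * (1 - t / 2))
  have h := RelMap.joined_of_family (A := A) (pt := pt)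
    (fun t => ⟨⟨fun p => K.1 (φ t p.1, p.2), by fun_prop⟩,
      fun v => by simpa [φ] using K.2.1 v,
      fun v => by
        change (if ((φ t 1 : I) : ℝ) ≤ 1 / 2 then
          H.1 (projIcc 0 1 zero_le_one (2 * ((φ t 1 : I) : ℝ)), v) else (γ _ : W)) ∈ A
        have ht0 := t.2.1
        have ht1 := t.2.2
        have e : ((φ t 1 : I) : ℝ) = 1 - t / 2 := by
          simp only [φ, Icc.coe_one, one_mul]
          rw [projIcc_of_mem zero_le_one (⟨by linarith, by linarith⟩ : 1 - (t : ℝ) / 2 ∈ Icc (0 : ℝ) 1)]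
        rw [e]
        split_ifs with h
        · rw [projIcc_of_right_le _ (by linarith)]
          exact (H.2.2.1 v).symm ▸ pt.2
        · exact (γ _).2,
      fun u => K.2.2.2.1 _, fun u => K.2.2.2.2 _⟩)
    (by
      change Continuous fun p : I × (I × I) => K.1 (φ p.1 p.2.1, p.2.2)
      fun_prop)
  convert h using 1
  · exact RelMap.ext fun u v => by simp [φ, K, HomotopyMap.toRel]
  · refine RelMap.ext fun u v => ?_
    have hu0 := u.2.1
    have hu1 := u.2.2
    have e : ((φ 1 u : I) : ℝ) = u / 2 := by
      simp only [φ, Icc.coe_one]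
      rw [projIcc_of_mem zero_le_one 
        (⟨by linarith, by linarith⟩ : (u : ℝ) * (1 - 1 / 2) ∈ Icc (0 : ℝ) 1)]
      ring
    change H.1 (u, v) = if ((φ 1 u : I) : ℝ) ≤ 1 / 2 then
      H.1 (projIcc 0 1 zero_le_one (2 * ((φ 1 u : I) : ℝ)), v) else (γ _ : W)
    rw [e, if_pos (by linarith), mul_div_cancel₀ _ two_ne_zero, projIcc_val]

/-- A homotopy map with values in `A` represents an identity class. -/
theorem HomotopyMap.mk_eq_one_of_mem (H : HomotopyMap A pt) (h : ∀ p, H.1 p ∈ A) :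
    (ZerothHomotopy.mk H : HClass A pt) = HClass.oneHom (loopClass H.bottom) := by
  rw [HClass.oneHom_loopClass, HClass.mk_eq_iff]
  -- The square is flattened onto its bottom edge; the moving top edge is allowed since every value
  -- lies in `A`.
  have hj := joined_of_family (A := A) (pt := pt)
    (fun t => ⟨⟨fun p => H.1 (p.1, t * p.2), by fun_prop⟩, fun v => H.2.1 _, fun v => H.2.2.1 _,
      fun u => h _, fun u => h _⟩)
    (by
      change Continuous fun p : I × (I × I) => H.1 (p.2.1, p.1 * p.2.2)
      fun_prop)
  refine Joined.symm ?_
  convert hj using 1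
  · ext u v
    simp [const, bottom]
  · ext u v
    simp

/-- A path of relative maps moves the right edge inside `A`. Appending the track of that edge back
to its initial constant position turns it into a path of homotopy maps, from `H · 1` to `H' · R`
with `R` in `A`; such an `R` is an identity class. -/
theorem immersion_eq_iff {q q' : HClass A pt} :
    immersion q = immersion q' ↔ ∃ x, q = q' * HClass.oneHom x := by
  constructor
  swap
  · rintro ⟨x, rfl⟩
    exact immersion_mul_oneHom _ _
  induction q using ZerothHomotopy.rec with | mk H
  induction q' using ZerothHomotopy.rec with | mk H'
  rw [immersion_mk, immersion_mk, RelMap.mk_eq_iff]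
  rintro ⟨Γ⟩
  have hΓ := RelMap.continuous_family Γ.continuous
  -- The parameter `t * σ u` falls from `t` to `0`: the added block starts at the right edge of `Γ
  -- t` and ends at that of `Γ 0`, which is constant.
  have hg : Continuous fun p : I × (I × I) => (Γ (p.1 * σ p.2.1)).1 (1, p.2.2) :=
    hΓ.comp (by fun_prop : Continuous fun p : I × (I × I) => (p.1 * σ p.2.1, ((1 : I), p.2.2)))
  have hH (v : I) : (Γ 0).1 (1, v) = pt := by rw [Γ.source]; exact H.2.2.1 v
  have hG := HomotopyMap.continuous_glue hΓ hg (fun t v => by simp)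
  let G (t : I) : HomotopyMap A pt :=
    ⟨⟨fun p => if (p.1 : ℝ) ≤ 1 / 2 then (Γ t).1 (projIcc 0 1 zero_le_one (2 * (p.1 : ℝ)), p.2)
        else (Γ (t * σ (projIcc 0 1 zero_le_one (2 * (p.1 : ℝ) - 1)))).1 (1, p.2),
        hG.comp (by fun_prop : Continuous fun p : I × I => (t, p))⟩,
      fun v => by simpa using (Γ t).2.1 v,
      fun v => by
        have h : ¬ (((1 : I) : ℝ) ≤ 1 / 2) := by norm_num
        have h2 : projIcc (0 : ℝ) 1 zero_le_one (2 * ((1 : I) : ℝ) - 1) = 1 := by norm_num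
        simp only [ContinuousMap.coe_mk]
        rw [if_neg h, h2, symm_one, mul_zero, hH],
      fun u => by
        simp only [ContinuousMap.coe_mk]
        split_ifs
        exacts [(Γ _).2.2.2.1 _, (Γ _).2.2.2.1 _],
      fun u => by
        simp only [ContinuousMap.coe_mk]
        split_ifs
        exacts [(Γ _).2.2.2.2 _, (Γ _).2.2.2.2 _]⟩
  let R : HomotopyMap A pt :=
    ⟨⟨fun p => (Γ (σ p.1)).1 (1, p.2), hΓ.comp
        (by fun_prop : Continuous fun p : I × I => (σ p.1, ((1 : I), p.2)))⟩,
      fun v => by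
        simp only [ContinuousMap.coe_mk, symm_zero, Γ.target]
        exact H'.2.2.1 v,
      fun v => by simp only [ContinuousMap.coe_mk, symm_one, hH],
      fun u => (Γ _).2.2.2.1 1, fun u => (Γ _).2.2.2.2 1⟩
  have e₀ : G 0 = H.hcomp (HomotopyMap.const (Path.refl pt)) := by
    ext u v
    change (if (u : ℝ) ≤ 1 / 2 then (Γ 0).1 (_, v) else (Γ (0 * _)).1 (1, v)) =
      if (u : ℝ) ≤ 1 / 2 then H.1 (_, v) else (pt : W)
    rw [zero_mul, hH, Γ.source]
    rfl
  have e₁ : G 1 = H'.hcomp R := by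
    ext u v
    change (if (u : ℝ) ≤ 1 / 2 then (Γ 1).1 (_, v) else (Γ (1 * σ _)).1 (1, v)) =
      if (u : ℝ) ≤ 1 / 2 then H'.1 (_, v) else (Γ (σ _)).1 (1, v)
    rw [one_mul, Γ.target]
    rfl
  have hj : Joined (G 0) (G 1) := joined_of_family G hG
  rw [e₀, e₁, ← HClass.mk_eq_iff, HClass.mk_hcomp, HClass.mk_hcomp, ← HClass.oneHom_loopClass,
    loopClass_refl, map_one, mul_one, R.mk_eq_one_of_mem fun p => (Γ _).2.2.1 _] at hj
  exact ⟨_, hj⟩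

/-- A map `([0,1]², ∂[0,1]²) → (W, pt)` as a homotopy map. -/
def HomotopyMap.ofGenLoop (g : Ω^ (Fin 2) W (pt : W)) : HomotopyMap A pt :=
  ⟨⟨fun p => g ![p.1, p.2], g.1.continuous.comp continuous_pair⟩,
    fun v => g.2 _ (pair_mem_boundary (p := (0, v)) (by simp)),
    fun v => g.2 _ (pair_mem_boundary (p := (1, v)) (by simp)),
    (RelMap.ofGenLoop g).2.2.2⟩

theorem HomotopyMap.ofGenLoop_transAt (g g' : Ω^ (Fin 2) W (pt : W)) :
    (ofGenLoop (GenLoop.transAt 0 g g') : HomotopyMap A pt) =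
      (ofGenLoop g).hcomp (ofGenLoop g') := by
  have hu (x u v : I) : Function.update ![u, v] 0 x = ![x, v] := by
    funext i; fin_cases i <;> rfl
  ext u v
  change (if (u : ℝ) ≤ 1 / 2 then g (Function.update ![u, v] 0 _)
      else g' (Function.update ![u, v] 0 _)) =
    if (u : ℝ) ≤ 1 / 2 then g ![projIcc 0 1 zero_le_one (2 * (u : ℝ)), v]
      else g' ![projIcc 0 1 zero_le_one (2 * (u : ℝ) - 1), v]
  rw [hu, hu]
  rfl

variable (A pt) in
/-- The map `π₂(W, pt) → [1, 1]`. -/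
def pi2ToHClass (s : π_ 2 W (pt : W)) : HClass A pt :=
  Quotient.lift (s := GenLoop.Homotopic.setoid (Fin 2) (pt : W))
    (fun g => (ZerothHomotopy.mk (HomotopyMap.ofGenLoop g) : HClass A pt))
    (by
      rintro g g' ⟨F⟩
      refine Quotient.sound ?_
      have hF : ∀ t, ∀ y ∈ Cube.boundary (Fin 2), F (t, y) = pt :=
        fun t y hy => (F.eq_fst t hy).trans (g.2 y hy)
      have h := joined_of_family (A := A) (pt := pt)
        (fun t => HomotopyMap.ofGenLoop ⟨⟨fun y => F (t, y), by fun_prop⟩, hF t⟩)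
        (F.continuous.comp (continuous_fst.prodMk (continuous_pair.comp continuous_snd)))
      change Joined _ _
      convert h using 1
      · exact congrArg HomotopyMap.ofGenLoop (GenLoop.ext _ _ fun y => (F.apply_zero y).symm)
      · exact congrArg HomotopyMap.ofGenLoop (GenLoop.ext _ _ fun y => (F.apply_one y).symm)) s

theorem pi2ToHClass_mk (g : Ω^ (Fin 2) W (pt : W)) :
    pi2ToHClass A pt (Quotient.mk _ g) = ZerothHomotopy.mk (HomotopyMap.ofGenLoop g) := rfl

theorem immersion_pi2ToHClass (s : π_ 2 W (pt : W)) :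
    immersion (pi2ToHClass A pt s) = pi2ToRel A pt s := by
  induction s using Quotient.inductionOn with | h g
  rfl

theorem src_pi2ToHClass (s : π_ 2 W (pt : W)) : HClass.src (pi2ToHClass A pt s) = 1 := by
  induction s using Quotient.inductionOn with | h g
  exact congrArg loopClass (Path.ext (funext fun u =>
    Subtype.ext (g.2 _ (pair_mem_boundary (p := (u, 0)) (by simp)))))

theorem tgt_pi2ToHClass (s : π_ 2 W (pt : W)) : HClass.tgt (pi2ToHClass A pt s) = 1 := by
  induction s using Quotient.inductionOn with | h g
  exact congrArg loopClass (Path.ext (funext fun u =>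
    Subtype.ext (g.2 _ (pair_mem_boundary (p := (u, 1)) (by simp)))))

variable (A pt) in
/-- The homomorphism from `π₂(W, pt)` to the group of homotopy classes. -/
def pi2Hom : π_ 2 W (pt : W) →* HClass A pt :=
  MonoidHom.mk' (pi2ToHClass A pt) (by
    intro s s'
    -- `HomotopyGroup.mul_spec` concatenates representatives in the opposite order, which
    -- commutativity absorbs.
    rw [HClass.commute (tgt_pi2ToHClass s) (src_pi2ToHClass s')]
    induction s using Quotient.inductionOn with | h g
    induction s' using Quotient.inductionOn with | h g'
    refine (congrArg (pi2ToHClass A pt)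
      (HomotopyGroup.mul_spec (i := (0 : Fin 2)) (p := g) (q := g'))).trans ?_
    rw [pi2ToHClass_mk, HomotopyMap.ofGenLoop_transAt, HClass.mk_hcomp]
    rfl)

theorem HomotopyMap.exists_ofGenLoop (H : HomotopyMap A pt) (h₀ : ∀ u, H.1 (u, 0) = pt)
    (h₁ : ∀ u, H.1 (u, 1) = pt) : ∃ g, ofGenLoop g = H := by
  refine ⟨⟨⟨fun y => H.1 (y 0, y 1), by fun_prop⟩, ?_⟩, by ext u v; rfl⟩
  intro y hy
  change H.1 (y 0, y 1) = pt
  obtain ⟨i, hi⟩ := hy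
  fin_cases i <;> rcases hi with hi | hi <;> simp only [Fin.zero_eta, Fin.mk_one] at hi <;> rw [hi]
  exacts [H.2.1 _, H.2.2.1 _, h₀ _, h₁ _]

/-- Collars along null-homotopies of the top and bottom edges make the whole boundary constant
without changing the class. -/
theorem exists_pi2Hom_eq {q : HClass A pt} (h₀ : HClass.src q = 1) (h₁ : HClass.tgt q = 1) :
    ∃ s, pi2Hom A pt s = q := by
  induction q using ZerothHomotopy.rec with | mk H
  obtain ⟨F₁⟩ := loopClass_eq_iff.1 (h₁.trans loopClass_refl.symm)
  let H₁ := H.collar rfl F₁ 1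
  have e₁ (u : I) : H₁.1 (u, 1) = pt := by rw [H.collar_top, F₁.apply_one]; rfl
  have e : H₁.symm.top = H.bottom := by
    ext u
    change H₁.1 (u, σ 1) = H.1 (u, 0)
    rw [symm_one, H.collar_bottom]
  obtain ⟨F₀⟩ := loopClass_eq_iff.1 (h₀.trans loopClass_refl.symm)
  let H₂ := H₁.symm.collar e F₀ 1
  obtain ⟨g, hg⟩ := H₂.symm.exists_ofGenLoop
    (fun u => by
      change H₂.1 (u, σ 0) = pt
      rw [symm_zero, HomotopyMap.collar_top, F₀.apply_one]; rfl)
    (fun u => by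
      change H₂.1 (u, σ 1) = pt
      rw [symm_one, HomotopyMap.collar_bottom]
      change H₁.1 (u, σ 0) = pt
      rw [symm_zero, e₁])
  refine ⟨Quotient.mk _ g, (pi2ToHClass_mk g).trans ?_⟩
  rw [hg, HClass.mk_eq_iff]
  have h := HomotopyMap.symm_joined (H₁.symm.collar_joined e F₀)
  rw [HomotopyMap.symm_symm] at h
  exact ((H.collar_joined rfl F₁).trans h).symm

/-- The immersion determines a class up to a right factor `1_y`, and the known bottom edge forces `y
= x`. -/
theorem mem_toPi2_iff {x : LoopGroup A pt} {S : Set (HClass A pt)}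
    (hS : S ⊆ HClass.between x x) {s : π_ 2 W (pt : W)} :
    s ∈ toPi2 S ↔ pi2Hom A pt s * HClass.oneHom x ∈ S := by
  constructor
  · rintro ⟨q, hq, h⟩
    rw [← immersion_pi2ToHClass] at h
    obtain ⟨y, rfl⟩ := immersion_eq_iff.1 h
    have := (HClass.mem_between_iff.1 (hS hq)).1
    rw [map_mul, src_pi2ToHClass, HClass.src_oneHom, one_mul] at this
    rwa [← this]
  · intro h
    exact ⟨_, h, (immersion_mul_oneHom _ _).trans (immersion_pi2ToHClass s)⟩

theorem mem_toPi2_differences_iff {x y : LoopGroup A pt} {S S' : Set (HClass A pt)}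
    (hS : S ⊆ HClass.between x y) (hS' : S' ⊆ HClass.between x y) {s : π_ 2 W (pt : W)} :
    s ∈ toPi2 (HClass.differences S S') ↔ ∃ h ∈ S, ∃ h' ∈ S', pi2Hom A pt s = h * h'⁻¹ := by
  have key {h h' q : HClass A pt} (hh : h ∈ S) (hh' : h' ∈ S') :
      HClass.IsVComp h h'.symm q ↔ q = h * h'⁻¹ * HClass.oneHom x := by
    obtain ⟨h1, h2⟩ := HClass.mem_between_iff.1 (hS hh)
    obtain ⟨h1', h2'⟩ := HClass.mem_between_iff.1 (hS' hh')
    rw [HClass.isVComp_iff, HClass.symm_eq]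
    simp [h2, h1', h2', mul_assoc]
  rw [mem_toPi2_iff (x := x)]
  · constructor
    · rintro ⟨h, hh, h', hh', e⟩
      exact ⟨h, hh, h', hh', mul_right_cancel ((key hh hh').1 e)⟩
    · rintro ⟨h, hh, h', hh', e⟩
      exact ⟨h, hh, h', hh', (key hh hh').2 (by rw [e])⟩
  · rintro q ⟨h, hh, h', hh', e⟩
    obtain ⟨h1, h2⟩ := HClass.mem_between_iff.1 (hS hh)
    obtain ⟨h1', h2'⟩ := HClass.mem_between_iff.1 (hS' hh')
    rw [(key hh hh').1 e, HClass.mem_between_iff]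
    simp [h1, h2, h1', h2']

/-! ### Groupoid laws for the vertical product -/

namespace HClass

theorem IsVComp.src_eq {q₁ q₂ q₃ : HClass A pt} (h : IsVComp q₁ q₂ q₃) : src q₃ = src q₁ := by
  obtain ⟨h1, rfl⟩ := isVComp_iff.1 h
  simp [h1]

theorem IsVComp.tgt_eq {q₁ q₂ q₃ : HClass A pt} (h : IsVComp q₁ q₂ q₃) : tgt q₃ = tgt q₂ := by
  obtain ⟨h1, rfl⟩ := isVComp_iff.1 h
  simp

theorem IsVComp.exists_assoc {q₁ q₂ q₃ q₂₃ q : HClass A pt} (h : IsVComp q₂ q₃ q₂₃)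
    (h' : IsVComp q₁ q₂₃ q) : ∃ q₁₂, IsVComp q₁ q₂ q₁₂ ∧ IsVComp q₁₂ q₃ q := by
  have e : tgt q₁ = src q₂ := h'.tgt_eq_src.trans h.src_eq
  have h12 := isVComp_iff.2 ⟨e, rfl⟩
  refine ⟨_, h12, isVComp_iff.2 ⟨h12.tgt_eq.trans h.tgt_eq_src, ?_⟩⟩
  rw [h12.tgt_eq, (isVComp_iff.1 h').2, (isVComp_iff.1 h).2]
  simp only [mul_assoc]

@[simp]
theorem src_symm (q : HClass A pt) : src q.symm = tgt q := (isVComp_symm q).tgt_eq_src.symm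

@[simp]
theorem tgt_symm (q : HClass A pt) : tgt q.symm = src q := by
  have h := (isVComp_symm q).tgt_eq
  rwa [tgt_oneHom, eq_comm] at h

@[simp]
theorem symm_symm (q : HClass A pt) : q.symm.symm = q := by
  rw [symm_eq q.symm, src_symm, tgt_symm, symm_eq]
  group

theorem symm_oneHom (x : LoopGroup A pt) : (oneHom x : HClass A pt).symm = oneHom x := by
  rw [symm_eq]
  simp

theorem symm_translate (x y : LoopGroup A pt) (q : HClass A pt) :
    (translate x y q).symm = translate x y q.symm := by
  simp only [translate_eq, symm_eq, map_mul, src_oneHom, tgt_oneHom]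
  group

theorem symm_isVComp (q : HClass A pt) : IsVComp q.symm q (oneHom (tgt q)) := by
  have h := isVComp_symm q.symm
  rwa [symm_symm, src_symm] at h

theorem IsVComp.symm {q₁ q₂ q₃ : HClass A pt} (h : IsVComp q₁ q₂ q₃) :
    IsVComp q₂.symm q₁.symm q₃.symm := by
  obtain ⟨h1, h2⟩ := isVComp_iff.1 h
  refine isVComp_iff.2 ⟨by rw [tgt_symm, src_symm, h1], ?_⟩
  rw [tgt_symm, symm_eq q₁, symm_eq q₂, symm_eq q₃, h.src_eq, h.tgt_eq, h2, ← h1]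
  group

theorem oneHom_isVComp (x : LoopGroup A pt) :
    IsVComp (oneHom x : HClass A pt) (oneHom x) (oneHom x) := by
  simpa using isVComp_one (oneHom x : HClass A pt)

theorem isVComp_translate (x y : LoopGroup A pt) {q₁ q₂ q₃ : HClass A pt}
    (h : IsVComp q₁ q₂ q₃) :
    IsVComp (translate x y q₁) (translate x y q₂) (translate x y q₃) := by
  simp only [translate_eq]
  exact ((oneHom_isVComp x).mul h).mul (oneHom_isVComp y)

theorem translate_translate (x y x' y' : LoopGroup A pt) (q : HClass A pt) :
    translate x y (translate x' y' q) = translate (x * x') (y' * y) q := by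
  simp only [translate_eq, map_mul, mul_assoc]

theorem translate_oneHom (x y z : LoopGroup A pt) :
    translate x y (oneHom z : HClass A pt) = oneHom (x * z * y) := by
  simp only [translate_eq, map_mul]

end HClass

end System

section Presentation

variable {W : Type*} [TopologicalSpace W] [T2Space W] [CWComplex (univ : Set W)]
  {B : OneVertexComplex W} {Λ M : Type*} {P : SemiPositivePresentation B Λ M}

open HClass

namespace GeometricRelations

variable {Rg : GeometricRelations P}

/-! ### The groupoid of `R_g`-sets -/

theorem Mem.src_eq {x y : FreeMonoid Λ} {q : HClass (graph W) B.pt} (h : Rg.Mem x y q) :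
    src q = P.eval x := by
  induction h with
  | one => exact src_oneHom _
  | forward _ _ hs ih => rw [hs.src_eq, ih]
  | backward _ _ hs ih => rw [hs.src_eq, ih]

theorem Mem.tgt_eq {x y : FreeMonoid Λ} {q : HClass (graph W) B.pt} (h : Rg.Mem x y q) :
    tgt q = P.eval y := by
  induction h with
  | one => exact tgt_oneHom _
  | forward _ hr hs =>
    rw [hs.tgt_eq, translate_eq]
    simp [(mem_between_iff.1 (Rg.subset _ hr)).2]
  | backward _ hr hs =>
    rw [hs.tgt_eq, translate_eq]
    simp [(mem_between_iff.1 (Rg.subset _ hr)).1]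

theorem Mem.oneHom (x : FreeMonoid Λ) : Rg.Mem x x (HClass.oneHom (P.eval x)) := Mem.one x

/-- Induction on the second factor: products grow on the right, so associativity moves the last
elementary step outside. -/
theorem Mem.vcomp {x y z : FreeMonoid Λ} {q q' s : HClass (graph W) B.pt} (h : Rg.Mem x y q)
    (h' : Rg.Mem y z q') (hs : IsVComp q q' s) : Rg.Mem x z s := by
  induction h' generalizing s with
  | one =>
    obtain ⟨h1, rfl⟩ := isVComp_iff.1 hs
    rw [one_eq, h.tgt_eq]
    simpa using h
  | forward _ hr hs' ih =>
    obtain ⟨t, ht, ht'⟩ := hs'.exists_assoc hs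
    exact (ih ht).forward hr ht'
  | backward _ hr hs' ih =>
    obtain ⟨t, ht, ht'⟩ := hs'.exists_assoc hs
    exact (ih ht).backward hr ht'

theorem Mem.of_rel (a d : FreeMonoid Λ) {μ : M} {r : HClass (graph W) B.pt} (hr : r ∈ Rg.rel μ) :
    Rg.Mem (a * P.lhs μ * d) (a * P.rhs μ * d) (HClass.translate (P.eval a) (P.eval d) r) := by
  refine (Mem.one _).forward hr ?_
  have h := one_isVComp (HClass.translate (P.eval a) (P.eval d) r)
  have e : src (HClass.translate (P.eval a) (P.eval d) r) = P.eval (a * P.lhs μ * d) := by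
    simp [translate_eq, (mem_between_iff.1 (Rg.subset _ hr)).1]
  rwa [e] at h

theorem Mem.of_rel_symm (a d : FreeMonoid Λ) {μ : M} {r : HClass (graph W) B.pt}
    (hr : r ∈ Rg.rel μ) :
    Rg.Mem (a * P.rhs μ * d) (a * P.lhs μ * d) (HClass.translate (P.eval a) (P.eval d) r.symm) := by
  refine (Mem.one _).backward hr ?_
  have h := one_isVComp (HClass.translate (P.eval a) (P.eval d) r.symm)
  have e : src (HClass.translate (P.eval a) (P.eval d) r.symm) = P.eval (a * P.rhs μ * d) := by
    simp [translate_eq, (mem_between_iff.1 (Rg.subset _ hr)).2]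
  rwa [e] at h

theorem Mem.symm {x y : FreeMonoid Λ} {q : HClass (graph W) B.pt} (h : Rg.Mem x y q) :
    Rg.Mem y x q.symm := by
  induction h with
  | one =>
    rw [one_eq, symm_oneHom]
    exact Mem.one x
  | @forward a d μ q r s _ hr hs ih =>
    refine (Mem.of_rel_symm a d hr).vcomp ih ?_
    rw [← symm_translate]
    exact hs.symm
  | @backward a d μ q r s _ hr hs ih =>
    refine (Mem.of_rel a d hr).vcomp ih ?_
    have h := hs.symm
    rwa [symm_translate, HClass.symm_symm] at h

theorem Mem.translate (a d : FreeMonoid Λ) {x y : FreeMonoid Λ} {q : HClass (graph W) B.pt}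
    (h : Rg.Mem x y q) :
    Rg.Mem (a * x * d) (a * y * d) (HClass.translate (P.eval a) (P.eval d) q) := by
  induction h with
  | one =>
    rw [one_eq, translate_oneHom, ← map_mul, ← map_mul]
    exact Mem.one _
  | @forward a' d' μ q r s _ hr hs ih =>
    have e (w : FreeMonoid Λ) : a * (a' * w * d') * d = a * a' * w * (d' * d) := by
      simp only [mul_assoc]
    rw [e] at ih ⊢
    refine ih.forward hr ?_
    rw [map_mul, map_mul, ← HClass.translate_translate]
    exact isVComp_translate _ _ hs
  | @backward a' d' μ q r s _ hr hs ih =>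
    have e (w : FreeMonoid Λ) : a * (a' * w * d') * d = a * a' * w * (d' * d) := by
      simp only [mul_assoc]
    rw [e] at ih ⊢
    refine ih.backward hr ?_
    rw [map_mul, map_mul, ← HClass.translate_translate]
    exact isVComp_translate _ _ hs

/-- `q · q'` is the vertical product of the translates `q · 1` and `1 · q'`. -/
theorem Mem.mul {x y x' y' : FreeMonoid Λ} {q q' : HClass (graph W) B.pt} (h : Rg.Mem x y q)
    (h' : Rg.Mem x' y' q') : Rg.Mem (x * x') (y * y') (q * q') := by
  have h1 := h.translate 1 x'
  have h2 := h'.translate y 1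
  simp only [translate_eq, map_one, one_mul, mul_one] at h1 h2
  refine h1.vcomp h2 ?_
  have e1 := isVComp_one q
  have e2 := one_isVComp q'
  rw [h.tgt_eq] at e1
  rw [h'.src_eq] at e2
  exact e1.mul e2

variable (Rg) in
-- Equality in the monoid is the congruence generated by the relations, and each of its closure
-- rules is realised by an operation on `R_g`-sets. Non-emptiness of the given sets supplies the
-- generators.
theorem exists_mem {x y : FreeMonoid Λ} (h : P.toMonoid x = P.toMonoid y) :
    ∃ q, Rg.Mem x y q := by
  have h' : ConGen.Rel P.rels x y := Quotient.exact h
  clear h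
  induction h' with
  | of x y h =>
    obtain ⟨μ, rfl, rfl⟩ := h
    obtain ⟨r, hr⟩ := Rg.nonempty μ
    have h := Mem.of_rel (P := P) 1 1 hr
    rw [one_mul, mul_one, one_mul, mul_one] at h
    exact ⟨_, h⟩
  | refl x => exact ⟨_, Mem.one x⟩
  | symm _ ih =>
    obtain ⟨q, h⟩ := ih
    exact ⟨_, h.symm⟩
  | trans _ _ ih ih' =>
    obtain ⟨q, h⟩ := ih
    obtain ⟨q', h'⟩ := ih'
    exact ⟨_, h.vcomp h' (isVComp_iff.2 ⟨h.tgt_eq.trans h'.src_eq.symm, rfl⟩)⟩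
  | mul _ _ ih ih' =>
    obtain ⟨q, h⟩ := ih
    obtain ⟨q', h'⟩ := ih'
    exact ⟨_, h.mul h'⟩

/-! ### Division sets -/

variable {a b c d e : FreeMonoid Λ} {h k : HClass (graph W) B.pt}

/-- Division undoes translation because `oneHom` is a homomorphism into a group. -/
theorem mem_divisionSet_iff : h ∈ Rg.divisionSet a b c d ↔
    Rg.Mem (a * b * d) (a * c * d) (translate (P.eval a) (P.eval d) h) := by
  constructor
  · rintro ⟨m, hm, rfl⟩
    rw [division, HClass.translate_translate, mul_inv_cancel, inv_mul_cancel, translate_eq]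
    simp only [map_one, one_mul, mul_one]
    exact hm
  · intro hm
    refine ⟨_, hm, ?_⟩
    rw [division, HClass.translate_translate, mul_inv_cancel, inv_mul_cancel, translate_eq]
    simp

theorem divisionSet_subset : Rg.divisionSet a b c d ⊆ between (P.eval b) (P.eval c) := by
  intro h hh
  have hm := mem_divisionSet_iff.1 hh
  have h1 := hm.src_eq
  have h2 := hm.tgt_eq
  simp only [translate_eq, map_mul, src_oneHom, tgt_oneHom, mul_left_inj, mul_right_inj] at h1 h2
  exact mem_between_iff.2 ⟨h1, h2⟩

theorem src_of_mem_divisionSet (hh : h ∈ Rg.divisionSet a b c d) : src h = P.eval b :=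
  (mem_between_iff.1 (divisionSet_subset hh)).1

theorem tgt_of_mem_divisionSet (hh : h ∈ Rg.divisionSet a b c d) : tgt h = P.eval c :=
  (mem_between_iff.1 (divisionSet_subset hh)).2

variable (Rg) in
theorem divisionSet_nonempty (h : P.toMonoid (a * b * d) = P.toMonoid (a * c * d)) :
    (Rg.divisionSet a b c d).Nonempty := by
  obtain ⟨q, hq⟩ := Rg.exists_mem h
  exact ⟨_, q, hq, rfl⟩

variable (Rg) in
theorem oneHom_mem_divisionSet (a b d : FreeMonoid Λ) :
    oneHom (P.eval b) ∈ Rg.divisionSet a b b d := by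
  rw [mem_divisionSet_iff, translate_oneHom, ← map_mul, ← map_mul]
  exact Mem.one _

/-- The element is the vertical product `h ∘ k`, written in the group. -/
theorem mul_mem_divisionSet (hh : h ∈ Rg.divisionSet a b c d) (hk : k ∈ Rg.divisionSet a c e d) :
    h * (oneHom (P.eval c))⁻¹ * k ∈ Rg.divisionSet a b e d := by
  have h1 := tgt_of_mem_divisionSet hh
  refine mem_divisionSet_iff.2 ((mem_divisionSet_iff.1 hh).vcomp (mem_divisionSet_iff.1 hk)
    (isVComp_translate _ _ (isVComp_iff.2 ⟨h1.trans (src_of_mem_divisionSet hk).symm, ?_⟩)))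
  rw [h1]

/-- The element is the vertical inverse of `h`, written in the group. -/
theorem symm_mem_divisionSet (hh : h ∈ Rg.divisionSet a b c d) :
    oneHom (P.eval c) * h⁻¹ * oneHom (P.eval b) ∈ Rg.divisionSet a c b d := by
  have := (mem_divisionSet_iff.1 hh).symm
  rwa [symm_translate, ← mem_divisionSet_iff, symm_eq, src_of_mem_divisionSet hh,
    tgt_of_mem_divisionSet hh] at this

/-- The new element is `θ⁻¹ ∘ h ∘ φ`. With `α` and `δ` relating the outer words, `(α⁻¹ · θ⁻¹ · δ⁻¹)
∘ (1 · h · 1) ∘ (α · φ · δ)` is in the `R_g`-set, and by interchange `α` and `δ` cancel in the outer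
columns. -/
theorem mem_divisionSet_of_lift {a₂ b₂ c₂ d₂ : FreeMonoid Λ} {θ φ : HClass (graph W) B.pt}
    (ha : P.toMonoid a = P.toMonoid a₂) (hd : P.toMonoid d = P.toMonoid d₂)
    (hθ : Rg.Mem b b₂ θ) (hφ : Rg.Mem c c₂ φ) (hh : h ∈ Rg.divisionSet a b c d) :
    oneHom (P.eval b₂) * θ⁻¹ * h * (oneHom (P.eval c))⁻¹ * φ ∈ Rg.divisionSet a₂ b₂ c₂ d₂ := by
  obtain ⟨α, hα⟩ := Rg.exists_mem ha
  obtain ⟨δ, hδ⟩ := Rg.exists_mem hd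
  have h1 := src_of_mem_divisionSet hh
  have h2 := tgt_of_mem_divisionSet hh
  have eα := isVComp_one α.symm
  have eδ := isVComp_one δ.symm
  rw [tgt_symm, hα.src_eq] at eα
  rw [tgt_symm, hδ.src_eq] at eδ
  have e₁ : IsVComp θ.symm h (oneHom (P.eval b₂) * θ⁻¹ * h) :=
    isVComp_iff.2 ⟨by rw [tgt_symm, hθ.src_eq, h1], by
      rw [tgt_symm, symm_eq, hθ.src_eq, hθ.tgt_eq]; group⟩
  have e₂ : IsVComp (oneHom (P.eval b₂) * θ⁻¹ * h) φ
      (oneHom (P.eval b₂) * θ⁻¹ * h * (oneHom (P.eval c))⁻¹ * φ) :=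
    isVComp_iff.2 ⟨by rw [e₁.tgt_eq, h2, hφ.src_eq], by rw [e₁.tgt_eq, h2]⟩
  have m₁ := ((hα.symm.mul hθ.symm).mul hδ.symm).vcomp
    (translate_eq _ _ h ▸ mem_divisionSet_iff.1 hh) ((eα.mul e₁).mul eδ)
  have m₂ := m₁.vcomp ((hα.mul hφ).mul hδ) (((symm_isVComp α).mul e₂).mul (symm_isVComp δ))
  rwa [hα.tgt_eq, hδ.tgt_eq, ← translate_eq, ← mem_divisionSet_iff] at m₂

/-! ### Differences of division sets in the second homotopy group -/

variable {a' d' : FreeMonoid Λ}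

theorem mem_toPi2_iff {s : π_ 2 W (B.pt : W)} :
    s ∈ toPi2 (differences (Rg.divisionSet a b c d) (Rg.divisionSet a' b c d')) ↔
      ∃ h ∈ Rg.divisionSet a b c d, ∃ h' ∈ Rg.divisionSet a' b c d',
        pi2Hom (graph W) B.pt s = h * h'⁻¹ :=
  mem_toPi2_differences_iff divisionSet_subset divisionSet_subset

/-- Both tuples are transported with the same `θ` and `φ`. In the difference `φ` cancels and `θ`
leaves a conjugation, which is trivial on `h · h'⁻¹` by `commute`. Inclusion suffices, as the
hypotheses are symmetric in the two lifts. -/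
theorem toPi2_subset_of_lift {a₂ b₂ c₂ d₂ a₂' d₂' : FreeMonoid Λ}
    (ha : P.toMonoid a = P.toMonoid a₂) (hb : P.toMonoid b = P.toMonoid b₂)
    (hc : P.toMonoid c = P.toMonoid c₂) (hd : P.toMonoid d = P.toMonoid d₂)
    (ha' : P.toMonoid a' = P.toMonoid a₂') (hd' : P.toMonoid d' = P.toMonoid d₂') :
    toPi2 (differences (Rg.divisionSet a b c d) (Rg.divisionSet a' b c d')) ⊆
      toPi2 (differences (Rg.divisionSet a₂ b₂ c₂ d₂) (Rg.divisionSet a₂' b₂ c₂ d₂')) := by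
  intro s hs
  obtain ⟨h, hh, h', hh', e⟩ := mem_toPi2_iff.1 hs
  obtain ⟨θ, hθ⟩ := Rg.exists_mem hb
  obtain ⟨φ, hφ⟩ := Rg.exists_mem hc
  refine mem_toPi2_iff.2 ⟨_, mem_divisionSet_of_lift ha hd hθ hφ hh, _,
    mem_divisionSet_of_lift ha' hd' hθ hφ hh', ?_⟩
  have hcomm : oneHom (P.eval b₂) * θ⁻¹ * (h * h'⁻¹) =
      h * h'⁻¹ * (oneHom (P.eval b₂) * θ⁻¹) :=
    commute (by simp [hθ.tgt_eq])
      (by simp [src_of_mem_divisionSet hh, src_of_mem_divisionSet hh'])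
  rw [e, eq_comm]
  calc _ = oneHom (P.eval b₂) * θ⁻¹ * (h * h'⁻¹) * (oneHom (P.eval b₂) * θ⁻¹)⁻¹ := by group
    _ = _ := by rw [hcomm, mul_inv_cancel_right]

theorem toPi2_divisionInertia_subset
    (hne : P.toMonoid (a * b * d) = P.toMonoid (a * c * d))
    (hne' : P.toMonoid (a' * b * d') = P.toMonoid (a' * c * d')) :
    toPi2 (differences (Rg.divisionInertia a b d) (Rg.divisionInertia a' b d')) ⊆
      toPi2 (differences (Rg.divisionInertia a c d) (Rg.divisionInertia a' c d')) := by
  -- Conjugation by any `k` in the division set from `b` to `c` gives `k⁻¹ ∘ h ∘ k = h · 1_b⁻¹ ·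
  -- 1_c`. The result does not involve `k`, so the two tuples may use different ones, and the common
  -- factor cancels in the difference.
  have key {a d : FreeMonoid Λ} (hne : P.toMonoid (a * b * d) = P.toMonoid (a * c * d))
      {h : HClass (graph W) B.pt} (hh : h ∈ Rg.divisionInertia a b d) :
      h * (oneHom (P.eval b))⁻¹ * oneHom (P.eval c) ∈ Rg.divisionInertia a c d := by
    obtain ⟨k, hk⟩ := Rg.divisionSet_nonempty hne
    have hm := mul_mem_divisionSet (mul_mem_divisionSet (symm_mem_divisionSet hk) hh) hk
    have hcomm : oneHom (P.eval c) * k⁻¹ * (h * (oneHom (P.eval b))⁻¹) =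
        h * (oneHom (P.eval b))⁻¹ * (oneHom (P.eval c) * k⁻¹) :=
      commute (by simp [tgt_of_mem_divisionSet hk]) (by simp [src_of_mem_divisionSet hh])
    have e : h * (oneHom (P.eval b))⁻¹ * oneHom (P.eval c) = oneHom (P.eval c) * k⁻¹ *
        oneHom (P.eval b) * (oneHom (P.eval b))⁻¹ * h * (oneHom (P.eval b))⁻¹ * k := by
      calc _ = h * (oneHom (P.eval b))⁻¹ * (oneHom (P.eval c) * k⁻¹) * k := by group
        _ = _ := by rw [← hcomm]; group
    rw [e]
    exact hm
  intro s hs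
  obtain ⟨h, hh, h', hh', e⟩ := mem_toPi2_iff.1 hs
  refine mem_toPi2_iff.2 ⟨_, key hne hh, _, key hne' hh', ?_⟩
  rw [e]
  group

variable (Rg) in
/-- The global inertia group as a subgroup of the second homotopy group. -/
def inertiaSubgroup (a b d a' d' : FreeMonoid Λ) : Subgroup (π_ 2 W (B.pt : W)) where
  carrier := toPi2 (differences (Rg.divisionInertia a b d) (Rg.divisionInertia a' b d'))
  one_mem' := mem_toPi2_iff.2 ⟨_, Rg.oneHom_mem_divisionSet a b d, _,
    Rg.oneHom_mem_divisionSet a' b d', by simp⟩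
  mul_mem' {s t} hs ht := by
    obtain ⟨h, hh, h', hh', e⟩ := mem_toPi2_iff.1 hs
    obtain ⟨k, hk, k', hk', f⟩ := mem_toPi2_iff.1 ht
    refine mem_toPi2_iff.2 ⟨_, mul_mem_divisionSet hh hk, _, mul_mem_divisionSet hh' hk', ?_⟩
    -- The difference of `h ∘ k` and `h' ∘ k'` has `k · k'⁻¹` between `h` and `h'⁻¹`; it has to be
    -- moved to the end.
    have hcomm : oneHom (P.eval b) * h'⁻¹ * (k * k'⁻¹) =
        k * k'⁻¹ * (oneHom (P.eval b) * h'⁻¹) :=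
      commute (by simp [tgt_of_mem_divisionSet hh'])
        (by simp [src_of_mem_divisionSet hk, src_of_mem_divisionSet hk'])
    rw [map_mul, e, f]
    calc _ = h * (oneHom (P.eval b))⁻¹ * (oneHom (P.eval b) * h'⁻¹ * (k * k'⁻¹)) := by group
      _ = _ := by rw [hcomm]; group
  inv_mem' {s} hs := by
    obtain ⟨h, hh, h', hh', e⟩ := mem_toPi2_iff.1 hs
    refine mem_toPi2_iff.2 ⟨_, symm_mem_divisionSet hh, _, symm_mem_divisionSet hh', ?_⟩
    have hcomm : oneHom (P.eval b) * h⁻¹ * (h' * (oneHom (P.eval b))⁻¹) =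
        h' * (oneHom (P.eval b))⁻¹ * (oneHom (P.eval b) * h⁻¹) :=
      commute (by simp [tgt_of_mem_divisionSet hh]) (by simp [src_of_mem_divisionSet hh'])
    rw [map_inv, e]
    calc _ = h' * (oneHom (P.eval b))⁻¹ * (oneHom (P.eval b) * h⁻¹) := by group
      _ = _ := by rw [← hcomm]; group

/-- The differences of two division sets form a coset of the global inertia group. -/
theorem exists_toPi2_eq_coset
    (hne : P.toMonoid (a * b * d) = P.toMonoid (a * c * d))
    (hne' : P.toMonoid (a' * b * d') = P.toMonoid (a' * c * d')) :
    ∃ s, toPi2 (differences (Rg.divisionSet a b c d) (Rg.divisionSet a' b c d')) =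
      {x | ∃ g ∈ Rg.inertiaSubgroup a b d a' d', x = s * g} := by
  obtain ⟨h₀, hh₀⟩ := Rg.divisionSet_nonempty hne
  obtain ⟨h₀', hh₀'⟩ := Rg.divisionSet_nonempty hne'
  have b0 := src_of_mem_divisionSet hh₀
  have b0' := src_of_mem_divisionSet hh₀'
  have t0 := tgt_of_mem_divisionSet hh₀
  have t0' := tgt_of_mem_divisionSet hh₀'
  -- Both edges of `h₀ · h₀'⁻¹` are trivial, so this class comes from `π₂` and provides the
  -- representative of the coset.
  obtain ⟨s₀, e₀⟩ := exists_pi2Hom_eq (q := h₀ * h₀'⁻¹) (by simp [b0, b0']) (by simp [t0, t0'])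
  refine ⟨s₀, Subset.antisymm ?_ ?_⟩
  · intro s hs
    obtain ⟨h, hh, h', hh', e⟩ := mem_toPi2_iff.1 hs
    -- The quotient is the difference of the inertia elements `h ∘ h₀⁻¹` and `h' ∘ h₀'⁻¹`.
    refine ⟨s₀⁻¹ * s, mem_toPi2_iff.2 ⟨_, mul_mem_divisionSet hh (symm_mem_divisionSet hh₀), _,
      mul_mem_divisionSet hh' (symm_mem_divisionSet hh₀'), ?_⟩, by group⟩
    have hcomm : h₀' * h₀⁻¹ * (h * h₀⁻¹) = h * h₀⁻¹ * (h₀' * h₀⁻¹) :=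
      commute (by simp [t0, t0']) (by simp [b0, src_of_mem_divisionSet hh])
    rw [map_mul, map_inv, e, e₀]
    calc _ = h₀' * h₀⁻¹ * (h * h₀⁻¹) * (h₀ * h'⁻¹) := by group
      _ = _ := by rw [hcomm]; group
  · rintro s ⟨g, hg, rfl⟩
    obtain ⟨h, hh, h', hh', e⟩ := mem_toPi2_iff.1 hg
    -- Conversely, `h ∘ h₀` and `h' ∘ h₀'` lead from `b` to `c`, and their difference is `s₀ * g`.
    refine mem_toPi2_iff.2 ⟨_, mul_mem_divisionSet hh hh₀, _, mul_mem_divisionSet hh' hh₀', ?_⟩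
    have hcomm : h₀ * h₀'⁻¹ * (h * (oneHom (P.eval b))⁻¹) =
        h * (oneHom (P.eval b))⁻¹ * (h₀ * h₀'⁻¹) :=
      commute (by simp [t0, t0']) (by simp [src_of_mem_divisionSet hh])
    rw [map_mul, e, e₀]
    calc _ = h₀ * h₀'⁻¹ * (h * (oneHom (P.eval b))⁻¹) * (oneHom (P.eval b) * h'⁻¹) := by group
      _ = _ := by rw [hcomm]; group

end GeometricRelations

end Presentation

end PiClasses

end

/-! ### The proposition -/

theorem mainTheorem1 {W : Type*} [TopologicalSpace W] [T2Space W] [ConnectedSpace W]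
    [CWComplex (univ : Set W)] {B : PiClasses.OneVertexComplex W} {Λ M : Type*}
    (P : PiClasses.SemiPositivePresentation B Λ M) (Rg : PiClasses.GeometricRelations P)
    (a b c d a' d' : P.PosMonoid) (htwin : PiClasses.IsTwin a b c d a' d') :
    -- independence of the lifts
    (∀ l₁ l₂ : PiClasses.TwinLift P a b c d a' d',
      l₁.piClass Rg = l₂.piClass Rg ∧ l₁.globalInertia Rg = l₂.globalInertia Rg ∧
      l₁.globalInertiaSnd Rg = l₂.globalInertia Rg) ∧
    -- the global inertia group is a subgroup, and the class is one of its cosets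
    (∀ l : PiClasses.TwinLift P a b c d a' d', ∃ G : Subgroup (π_ 2 W (B.pt : W)),
      (G : Set (π_ 2 W (B.pt : W))) = l.globalInertia Rg ∧
      ∃ s : π_ 2 W (B.pt : W), l.piClass Rg = {x | ∃ g ∈ G, x = s * g}) := by
  have hword {x y z : P.PosMonoid} {wx wy wz : FreeMonoid Λ} (hx : P.toMonoid wx = x)
      (hy : P.toMonoid wy = y) (hz : P.toMonoid wz = z) :
      P.toMonoid (wx * wy * wz) = x * y * z := by
    rw [map_mul, map_mul, hx, hy, hz]
  have hne (l : PiClasses.TwinLift P a b c d a' d') :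
      P.toMonoid (l.wa * l.wb * l.wd) = P.toMonoid (l.wa * l.wc * l.wd) :=
    (hword l.map_a l.map_b l.map_d).trans
      (htwin.1.2.trans (hword l.map_a l.map_c l.map_d).symm)
  have hne' (l : PiClasses.TwinLift P a b c d a' d') :
      P.toMonoid (l.wa' * l.wb * l.wd') = P.toMonoid (l.wa' * l.wc * l.wd') :=
    (hword l.map_a' l.map_b l.map_d').trans
      (htwin.2.2.trans (hword l.map_a' l.map_c l.map_d').symm)
  have hpi (l₁ l₂ : PiClasses.TwinLift P a b c d a' d') : l₁.piClass Rg ⊆ l₂.piClass Rg :=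
    PiClasses.GeometricRelations.toPi2_subset_of_lift
      (l₁.map_a.trans l₂.map_a.symm) (l₁.map_b.trans l₂.map_b.symm)
      (l₁.map_c.trans l₂.map_c.symm) (l₁.map_d.trans l₂.map_d.symm)
      (l₁.map_a'.trans l₂.map_a'.symm) (l₁.map_d'.trans l₂.map_d'.symm)
  have hinertia (l₁ l₂ : PiClasses.TwinLift P a b c d a' d') :
      l₁.globalInertia Rg ⊆ l₂.globalInertia Rg :=
    PiClasses.GeometricRelations.toPi2_subset_of_lift
      (l₁.map_a.trans l₂.map_a.symm) (l₁.map_b.trans l₂.map_b.symm)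
      (l₁.map_b.trans l₂.map_b.symm) (l₁.map_d.trans l₂.map_d.symm)
      (l₁.map_a'.trans l₂.map_a'.symm) (l₁.map_d'.trans l₂.map_d'.symm)
  refine ⟨fun l₁ l₂ => ⟨Subset.antisymm (hpi _ _) (hpi _ _),
    Subset.antisymm (hinertia _ _) (hinertia _ _), Subset.antisymm ?_ ?_⟩, fun l => ?_⟩
  -- The roles of `b` and `c` are exchanged here.
  · exact (PiClasses.GeometricRelations.toPi2_divisionInertia_subset
      (hne l₁).symm (hne' l₁).symm).trans (hinertia l₁ l₂)
  · exact (hinertia l₂ l₁).trans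
      (PiClasses.GeometricRelations.toPi2_divisionInertia_subset (hne l₁) (hne' l₁))
  · exact ⟨Rg.inertiaSubgroup l.wa l.wb l.wd l.wa' l.wd', rfl,
      PiClasses.GeometricRelations.exists_toPi2_eq_coset (hne l) (hne' l)⟩
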